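/- **Conventions.** All matrices are real $2\times2$, $\|\cdot\|$ is the spectral norm, $|X|$ is the entrywise absolute value, $\operatorname{adj}$ is the adjugate, $J=\begin{bmatrix}0&1\\-1&0\end{bmatrix}$. Floating-point arithmetic follows the standard model with unit roundoff $\boldsymbol\epsilon>0$: for $\circ\in\{+,-,\cdot,/\}$ the computed result of $a\circ b$ is $\mathrm{fl}(a\circ b)=(a\circ b)(1+\epsilon)$ with $|\epsilon|\le\boldsymbol\epsilon$, and likewise for the square root; absolute values, negation, comparisons and multiplication by $0$ or $\pm1$ are exact; there is no overflow or underflow. Computed matrix products use $\mathrm{fl}(XY)_{ij}=\mathrm{fl}(\mathrm{fl}(x_{i1}y_{1j})+\mathrm{fl}(x_{i2}y_{2j}))$. Overlined quantities are computed ones. Higher-order terms are ignored in the following sense: there are absolute constants $\kappa,\epsilon_0>0$ such that for all $0<\boldsymbol\epsilon\le\epsilon_0$, all inputs and all arithmetics obeying the model, every bound $c\,\boldsymbol\epsilon$ below holds with $c\,\boldsymbol\epsilon+\kappa\boldsymbol\epsilon^2$ in its place. Two vectors are parallel if they are linearly dependent. That the rows (columns) of $X$ and $Y$ are within $\alpha$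 and $\beta$ of being parallel means that there are $E,F$ with $\|E\|\le\alpha$, $\|F\|\le\beta$ such that corresponding rows (columns) of $X+E$ and $Y+F$ are parallel. **Algorithm RSVD22.** Input: upper-triangular $A,B,C$ with $A$ nonsingular. (All steps are carried out in floating-point arithmetic.) The rotations are computed by LAPACK's routines (version 3.8.0, the rescaling against overflow and underflow being omitted): $\mathsf{xLARTG}(f,g)$ gives $c=f/\sqrt{f^2+g^2}$ and $s=g/\sqrt{f^2+g^2}$ up to a common sign, and $\mathsf{xLASV2}$ gives the rotations $U,V$ of an SVD of an upper-triangular matrix. 1. If $c_{11}=b_{22}=0$: compute, with $\mathsf{xLARTG}$, a rotation $V$ with $(V^TC)_{22}=0$ and a rotation $U$ with $(BU)_{11}=0$; let $Q=P=J$, $G=V^TC$, $L=BU$, $H=\operatorname{adj}(A)L$, $K=G\operatorname{adj}(A)$, $A'=P^TAQ$, $B'=P^TL$, $C'=GQ$; set $b'_{21}=c'_{21}=0$ and stop. 2. Compute $M=C\operatorname{adj}(A)B$ by the formula below, and rotations $U,V$ with $M=V\Sigma U^T$ by $\mathsf{xLASV2}$. If $c_{11},c_{22},b_{11},b_{22}$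 are all nonzero and $\max\{|u_{11}|,|v_{11}|\}<\max\{|u_{12}|,|v_{12}|\}$, replace $U,V$ by $UJ,VJ$. 3. Let $G=V^TC$ and, optionally, set $g_{22}=0$ if $c_{11}=0$. Let $L=BU$ and, optionally, set $l_{12}=0$ if $b_{22}=0$. Let $\widehat G=|V|^T|C|$, $H=\operatorname{adj}(A)L$, $\widehat L=|B||U|$, $\widehat H=|\operatorname{adj}(A)|\,\widehat L$, $K=G\operatorname{adj}(A)$, $\widehat K=\widehat G\,|\operatorname{adj}(A)|$. 4. Let $\eta_g=\frac{\widehat g_{11}+\widehat g_{12}}{|g_{11}|+|g_{12}|}$, $\eta_h=\frac{\widehat h_{12}+\widehat h_{22}}{|h_{12}|+|h_{22}|}$, $\eta_k=\frac{\widehat k_{11}+\widehat k_{12}}{|k_{11}|+|k_{12}|}$, $\eta_l=\frac{\widehat l_{12}+\widehat l_{22}}{|l_{12}|+|l_{22}|}$. 5. If $|h_{12}|+|h_{22}|=0$, or $|g_{11}|+|g_{12}|\ne0$ and $\eta_g\le\eta_h$, compute with $\mathsf{xLARTG}$ a rotation $Q$ such that $GQ$ is lower triangular; otherwise one such that $Q^TH$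 is lower triangular. 6. If $|k_{11}|+|k_{12}|=0$, or $|l_{12}|+|l_{22}|\ne0$ and $\eta_l\le\eta_k$, compute with $\mathsf{xLARTG}$ a rotation $P$ such that $P^TL$ is lower triangular; otherwise one such that $KP$ is lower triangular. 7. Let $A'=P^TAQ$, $B'=P^TL$, $C'=GQ$, and set $a'_{12}=b'_{12}=c'_{12}=0$. **Theorem.** Let $A,B,C$ be upper-triangular with $A$ nonsingular, and let $\overline A',\overline B',\overline C',\overline H,\overline K,\overline P,\overline Q,\overline U,\overline V$ be computed by RSVD22 in floating-point arithmetic, with or without each of the optional zeroings, where $$\overline M=\begin{bmatrix}\mathrm{fl}(\mathrm{fl}(c_{11}a_{22})b_{11})&\overline m_{12}\\0&\mathrm{fl}(c_{22}\,\mathrm{fl}(a_{11}b_{22}))\end{bmatrix},$$ $$\overline m_{12}=\mathrm{fl}\bigl(\mathrm{fl}\bigl(\mathrm{fl}(\mathrm{fl}(c_{11}a_{22})b_{12})+\mathrm{fl}(c_{12}\,\mathrm{fl}(a_{11}b_{22}))\bigr)-\mathrm{fl}(\mathrm{fl}(c_{11}a_{12})b_{22})\bigr).$$ Let $\overline H'$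 and $\overline K'$ be $\mathrm{fl}(\overline Q^T\overline H)$ and $\mathrm{fl}(\overline K\,\overline P)$ with their $(1,2)$ entries set to zero. Then, up to higher-order terms: 1. $\overline A'$, $\overline B'$, $\overline C'$ are (exactly) lower triangular. 2. $\overline V^T\overline M\,\overline U$ is within $132\boldsymbol\epsilon\|\overline M\|$ of a diagonal matrix. 3. The rows of $\overline C'$ and $\operatorname{adj}(\overline H')$ are within $86\boldsymbol\epsilon\|C\|$ and $93.5\boldsymbol\epsilon\|A\|\|B\|$, respectively, of being parallel. The columns of $\operatorname{adj}(\overline K')$ and $\overline B'$ are within $93.5\boldsymbol\epsilon\|A\|\|C\|$ and $86\boldsymbol\epsilon\|B\|$, respectively, of being parallel. 4. There are $\delta B,\delta C,\delta H,\delta K$ and orthogonal matrices $\mathcal P,\mathcal Q,U,V$ such that $V^T\overline M U$ is diagonal (an exact unnormalized SVD of $\overline M$), $$\overline B'=\mathcal P^T(B+\delta B)U,\qquad \overline H'=\mathcal Q^T(\operatorname{adj}(A)B+\delta H)U,$$ $$\overline C'=V^T(C+\delta C)\mathcal Q,\qquad \overline K'=V^T(C\operatorname{adj}(A)+\delta K)\mathcal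 P,$$ and $\|\delta B\|\le493\boldsymbol\epsilon\|B\|$, $\|\delta C\|\le493\boldsymbol\epsilon\|C\|$, $\|\delta H\|\le486\boldsymbol\epsilon\|A\|\|B\|$, $\|\delta K\|\le486\boldsymbol\epsilon\|A\|\|C\|$. -/

import Mathlib

open scoped Matrix Matrix.Norms.L2Operator

/-- Real `2 × 2` matrices. The scoped norm opened above is the spectral norm (operator 2-norm). -/
abbrev Mat2 : Type := Matrix (Fin 2) (Fin 2) ℝ

/-- The standard model of floating-point arithmetic with unit roundoff `u`: every elementary
operation returns the exact result up to a relative error of at most `u`, and multiplication by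
`1` and by `-1` is exact (multiplication by `0` is exact by `mul_err`). There is no overflow and no
underflow. Negation, absolute values and comparisons are exact, so they are those of `ℝ`.

The operations are total on `ℝ`. This covers every set of floating-point numbers closed under the
operations, since one can compute exactly outside that set. -/
structure FloatModel (u : ℝ) where
  add : ℝ → ℝ → ℝ
  sub : ℝ → ℝ → ℝ
  mul : ℝ → ℝ → ℝ
  div : ℝ → ℝ → ℝ
  sqrt : ℝ → ℝ
  add_err : ∀ a b : ℝ, ∃ e : ℝ, |e| ≤ u ∧ add a b = (a + b) * (1 + e)
  sub_err : ∀ a b : ℝ, ∃ e : ℝ, |e| ≤ u ∧ sub a b = (a - b) * (1 + e)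
  mul_err : ∀ a b : ℝ, ∃ e : ℝ, |e| ≤ u ∧ mul a b = (a * b) * (1 + e)
  div_err : ∀ a b : ℝ, b ≠ 0 → ∃ e : ℝ, |e| ≤ u ∧ div a b = (a / b) * (1 + e)
  sqrt_err : ∀ a : ℝ, 0 ≤ a → ∃ e : ℝ, |e| ≤ u ∧ sqrt a = Real.sqrt a * (1 + e)
  mul_one : ∀ a : ℝ, mul a 1 = a
  one_mul : ∀ a : ℝ, mul 1 a = a
  mul_neg_one : ∀ a : ℝ, mul a (-1) = -a
  neg_one_mul : ∀ a : ℝ, mul (-1) a = -a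

noncomputable section

/-- `J = rot(π/2)`. -/
def matJ : Mat2 := !![0, 1; -1, 0]

/-- The matrix `[c s; -s c]`. -/
def rotCS (p : ℝ × ℝ) : Mat2 := !![p.1, p.2; -p.2, p.1]

/-- Entrywise absolute value. -/
def absM (X : Mat2) : Mat2 := X.map (fun x => |x|)

/-- Set the `(1,2)` entry (one-based indices) to zero. -/
def zero12 (X : Mat2) : Mat2 := !![X 0 0, 0; X 1 0, X 1 1]

/-- Set the `(2,1)` entry (one-based indices) to zero. -/
def zero21 (X : Mat2) : Mat2 := !![X 0 0, X 0 1; 0, X 1 1]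

/-- Set the `(2,2)` entry (one-based indices) to zero. -/
def zero22 (X : Mat2) : Mat2 := !![X 0 0, X 0 1; X 1 0, 0]

/-- The Fortran intrinsic `SIGN(a, b)`: the absolute value of `a` with the sign of `b`. -/
def signF (a b : ℝ) : ℝ := if 0 ≤ b then |a| else -|a|

/-- Corresponding rows of `X` and `Y` are parallel, that is, linearly dependent. -/
def ParallelRows (X Y : Mat2) : Prop := ∀ i : Fin 2, ¬ LinearIndependent ℝ ![X i, Y i]

/-- Corresponding columns of `X` and `Y` are parallel. -/
def ParallelCols (X Y : Mat2) : Prop := ParallelRows Xᵀ Yᵀ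

/-- The results of the algorithm `RSVD22` (together with the intermediate `H` and `K`). -/
structure RSVD22Output where
  P : Mat2
  Q : Mat2
  U : Mat2
  V : Mat2
  H : Mat2
  K : Mat2
  A' : Mat2
  B' : Mat2
  C' : Mat2

namespace FloatModel

variable {u : ℝ}

/-- Computed product of two `2 × 2` matrices. -/
def mulM (fp : FloatModel u) (X Y : Mat2) : Mat2 :=
  Matrix.of fun i j => fp.add (fp.mul (X i 0) (Y 0 j)) (fp.mul (X i 1) (Y 1 j))

/-- The computed product `C adj(A) B` for upper-triangular `A`, `B`, `C`. -/
def prodM (fp : FloatModel u) (A B C : Mat2) : Mat2 :=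
  let p := fp.mul (C 0 0) (A 1 1)
  let q := fp.mul (A 0 0) (B 1 1)
  !![fp.mul p (B 0 0),
     fp.sub (fp.add (fp.mul p (B 0 1)) (fp.mul (C 0 1) q))
       (fp.mul (fp.mul (C 0 0) (A 0 1)) (B 1 1));
     0, fp.mul (C 1 1) q]

/-- LAPACK's `xLARTG` (in the absence of overflow and underflow, so without rescaling): returns
`(c, s)`, which in exact arithmetic satisfies `[c s; -s c] (f, g)ᵀ = (r, 0)ᵀ`. -/
def lartg (fp : FloatModel u) (f g : ℝ) : ℝ × ℝ :=
  if g = 0 then (1, 0)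
  else if f = 0 then (0, 1)
  else
    let r := fp.sqrt (fp.add (fp.mul f f) (fp.mul g g))
    let c := fp.div f r
    let s := fp.div g r
    if |g| < |f| ∧ c < 0 then (-c, -s) else (c, s)

/-- The generic part of LAPACK's `xLASV2`, for `|ht| ≤ |ft|`, `gt ≠ 0` and `gt` not huge compared
with `ft`. Returns `((clt, slt), (crt, srt))`. -/
def lasv2Core (fp : FloatModel u) (ft gt ht : ℝ) : (ℝ × ℝ) × (ℝ × ℝ) :=
  let d := fp.sub |ft| |ht|
  let l := if d = |ft| then 1 else fp.div d |ft|
  let m := fp.div gt ft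
  let t := fp.sub 2 l
  let mm := fp.mul m m
  let tt := fp.mul t t
  let s := fp.sqrt (fp.add tt mm)
  let r := if l = 0 then |m| else fp.sqrt (fp.add (fp.mul l l) mm)
  let a := fp.mul (1 / 2) (fp.add s r)
  let t' :=
    if mm = 0 then
      if l = 0 then fp.mul (signF 2 ft) (signF 1 gt)
      else fp.add (fp.div gt (signF d ft)) (fp.div m t)
    else fp.mul (fp.add (fp.div m (fp.add s t)) (fp.div m (fp.add r l))) (fp.add 1 a)
  let l' := fp.sqrt (fp.add (fp.mul t' t') 4)
  let crt := fp.div 2 l'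
  let srt := fp.div t' l'
  let clt := fp.div (fp.add crt (fp.mul srt m)) a
  let slt := fp.div (fp.mul (fp.div ht ft) srt) a
  ((clt, slt), (crt, srt))

/-- LAPACK's `xLASV2` (only the rotations): returns `((csl, snl), (csr, snr))`. In exact arithmetic
`[csl snl; -snl csl] [f g; 0 h] [csr -snr; snr csr]` is diagonal. The machine constant
`xLAMCH('EPS')` is the unit roundoff `u`. -/
def lasv2 (fp : FloatModel u) (f g h : ℝ) : (ℝ × ℝ) × (ℝ × ℝ) :=
  let ft := if |f| < |h| then h else f
  let ht := if |f| < |h| then f else h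
  let r : (ℝ × ℝ) × (ℝ × ℝ) :=
    if g = 0 then ((1, 0), (1, 0))
    else if |ft| < |g| ∧ fp.div |ft| |g| < u then
      ((1, fp.div ht g), (fp.div ft g, 1))
    else fp.lasv2Core ft g ht
  if |f| < |h| then ((r.2.2, r.2.1), (r.1.2, r.1.1)) else r

/-- The case `c₁₁ = b₂₂ = 0` of the algorithm: `V` and `U` are computed with `xLARTG` such that
`(Vᵀ C)₂₂ = 0` and `(B U)₁₁ = 0` in exact arithmetic, and `P = Q = J`. -/
def rsvdSpecial (fp : FloatModel u) (A B C : Mat2) : RSVD22Output :=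
  let V := (rotCS (fp.lartg (C 0 1) (C 1 1)))ᵀ
  let U := rotCS (fp.lartg (B 0 1) (B 0 0))
  let G := fp.mulM Vᵀ C
  let L := fp.mulM B U
  { P := matJ
    Q := matJ
    U := U
    V := V
    H := fp.mulM A.adjugate L
    K := fp.mulM G A.adjugate
    A' := fp.mulM (fp.mulM matJᵀ A) matJ
    B' := zero21 (fp.mulM matJᵀ L)
    C' := zero21 (fp.mulM G matJ) }

/-- The computed pair `(U, V)`: the rotations from `xLASV2` applied to the computed `M`, both
postmultiplied by `J` (which only exchanges and negates columns) if the entries of `B` and `C` on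
the diagonals are nonzero and `max(|u₁₁|, |v₁₁|) < max(|u₁₂|, |v₁₂|)`. -/
def rsvdUV (fp : FloatModel u) (A B C : Mat2) : Mat2 × Mat2 :=
  let M := fp.prodM A B C
  let w := fp.lasv2 (M 0 0) (M 0 1) (M 1 1)
  let V := (rotCS w.1)ᵀ
  let U := (rotCS w.2)ᵀ
  let cmax := max |U 0 0| |V 0 0|
  let smax := max |U 0 1| |V 0 1|
  if C 0 0 ≠ 0 ∧ C 1 1 ≠ 0 ∧ B 0 0 ≠ 0 ∧ B 1 1 ≠ 0 ∧ cmax < smax then (U * matJ, V * matJ)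
  else (U, V)

/-- The computed `Q`, which in exact arithmetic makes `G Q` or `Qᵀ H` lower triangular. -/
def rsvdQ (fp : FloatModel u) (A B C U V G H : Mat2) : Mat2 :=
  let Ghat := fp.mulM (absM V)ᵀ (absM C)
  let Hhat := fp.mulM (absM A.adjugate) (fp.mulM (absM B) (absM U))
  let dg := fp.add |G 0 0| |G 0 1|
  let dh := fp.add |H 0 1| |H 1 1|
  let ηg := fp.div (fp.add (Ghat 0 0) (Ghat 0 1)) dg
  let ηh := fp.div (fp.add (Hhat 0 1) (Hhat 1 1)) dh
  if dh = 0 ∨ (dg ≠ 0 ∧ ηg ≤ ηh) then (rotCS (fp.lartg (G 0 0) (G 0 1)))ᵀ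
  else rotCS (fp.lartg (H 1 1) (H 0 1))

/-- The computed `P`, which in exact arithmetic makes `Pᵀ L` or `K P` lower triangular. -/
def rsvdP (fp : FloatModel u) (A B C U V L K : Mat2) : Mat2 :=
  let Khat := fp.mulM (fp.mulM (absM V)ᵀ (absM C)) (absM A.adjugate)
  let Lhat := fp.mulM (absM B) (absM U)
  let dk := fp.add |K 0 0| |K 0 1|
  let dl := fp.add |L 0 1| |L 1 1|
  let ηk := fp.div (fp.add (Khat 0 0) (Khat 0 1)) dk
  let ηl := fp.div (fp.add (Lhat 0 1) (Lhat 1 1)) dl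
  if dk = 0 ∨ (dl ≠ 0 ∧ ηl ≤ ηk) then rotCS (fp.lartg (L 1 1) (L 0 1))
  else (rotCS (fp.lartg (K 0 0) (K 0 1)))ᵀ

/-- The case `c₁₁ ≠ 0` or `b₂₂ ≠ 0` of the algorithm. The flags `zg` and `zl` say whether the
optional zeroing of `g₂₂` (if `c₁₁ = 0`) and of `l₁₂` (if `b₂₂ = 0`) is carried out. -/
def rsvdGeneric (fp : FloatModel u) (A B C : Mat2) (zg zl : Bool) : RSVD22Output :=
  let U := (fp.rsvdUV A B C).1
  let V := (fp.rsvdUV A B C).2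
  let G := if zg = true ∧ C 0 0 = 0 then zero22 (fp.mulM Vᵀ C) else fp.mulM Vᵀ C
  let L := if zl = true ∧ B 1 1 = 0 then zero12 (fp.mulM B U) else fp.mulM B U
  let H := fp.mulM A.adjugate L
  let K := fp.mulM G A.adjugate
  let Q := fp.rsvdQ A B C U V G H
  let P := fp.rsvdP A B C U V L K
  { P := P
    Q := Q
    U := U
    V := V
    H := H
    K := K
    A' := zero12 (fp.mulM (fp.mulM Pᵀ A) Q)
    B' := zero12 (fp.mulM Pᵀ L)
    C' := zero12 (fp.mulM G Q) }

/-- The algorithm `RSVD22` in the floating-point arithmetic `fp`. -/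
def rsvd22 (fp : FloatModel u) (A B C : Mat2) (zg zl : Bool) : RSVD22Output :=
  if C 0 0 = 0 ∧ B 1 1 = 0 then fp.rsvdSpecial A B C else fp.rsvdGeneric A B C zg zl

end FloatModel

end

/-!
With `κ = 1` and `u₀ = 10⁻⁶`, every bound holds with room to spare, so second-order terms are absorbed
by the constants. Rounding errors are measured on a logarithmic scale (`RelClose`), on which
they are exactly additive under products, or, where terms may cancel, relative to the sum of the
absolute values of the terms (`NearBy`).

*Rotations.* `xLASV2` adds no terms of opposite signs after its initial subtractions, and these are
harmless, so each component of its rotations is within 40 roundings of the corresponding component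
for an exact SVD (`FloatModel.lasv2_relClose`); the exactness of its formulas is the eigenvector
equation for `MᵀM` (`isSVDRotation_formulas`). This gives the near diagonality of `VᵀMU`.

*Backward errors in the product.* The computed `M` factors exactly as `Ct * Nt` and as `Kt * Bt` with
`Ct`, `Nt`, `Kt`, `Bt` entrywise close to `C`, `adj(A) B`, `C adj(A)`, `B`
(`FloatModel.exists_productFactors`). With the exact rotations, `(Vᵀ Ct) (Nt U)` and `(Vᵀ Kt) (Bt U)`
are therefore exactly diagonal, and the computed `G`, `H`, `K`, `L` are entrywise close to these
factors. An optional zeroing replaces entries by those of the perturbed factors, which vanish exactly.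
A product `X * Y` is diagonal only if the rows of `X` are parallel to those of `adj Y`, which yields
the near parallelism.

*Middle rotations.* If `Q` annihilates the (1,2) entry of `G Q`, then the (1,2) entry of `Qᵀ H` is the
inner product of the second column of `H` with the normalized first row of `G`. It vanishes for the
perturbed factors, and the errors, relative to the computed row and column, are proportional to the
growth factors `η`. Choosing the factor with the smaller growth keeps this entry at rounding level
(`abs_inner_le_of_growth_le`), so setting it to zero is a small perturbation. The pair `(K, L)` with
`P` is treated in the same way, and all factors share the same exact `U`, `V`, `P`, `Q`.

Upper-triangular `2 × 2` matrices have the same norm as their entrywise absolute values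
(`Mat2.norm_absM_le`), so that entrywise errors turn into norm bounds without extra factors.
-/

/-! ### Relative error calculus -/

/-- `-log (1 - u)`: the largest `|log (1 + e)|` for `|e| ≤ u`. Relative errors measured on the
logarithmic scale are exactly additive under products, so no higher-order terms occur. -/
noncomputable def logUnit (u : ℝ) : ℝ := -Real.log (1 - u)

/-- `x` equals `y` up to a factor `exp t` with `|t|` at most `k` logarithmic units. -/
def RelClose (u k x y : ℝ) : Prop := ∃ t : ℝ, |t| ≤ k * logUnit u ∧ x = y * Real.exp t

/-- `x` approximates `y` with an error of at most `k` roundings relative to `z ≥ |y|`. In a sum with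
cancellation, `z` is the sum of the absolute values of the terms. -/
def NearBy (u k x y z : ℝ) : Prop := |x - y| ≤ (Real.exp (k * logUnit u) - 1) * z ∧ |y| ≤ z

theorem logUnit_nonneg {u : ℝ} (hu : 0 < u) (hu' : u ≤ 1 / 10 ^ 6) : 0 ≤ logUnit u := by
  unfold logUnit
  have := Real.log_nonpos (x := 1 - u) (by linarith) (by linarith)
  linarith

theorem logUnit_le {u : ℝ} (hu : 0 < u) (hu' : u ≤ 1 / 10 ^ 6) :
    logUnit u ≤ u * (1 + 1 / 10 ^ 5) := by
  unfold logUnit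
  have h1 : (0 : ℝ) < 1 - u := by linarith
  have h := Real.one_sub_inv_le_log_of_pos h1
  have h2 : (1 - u)⁻¹ ≤ 1 + u * (1 + 1 / 10 ^ 5) := by
    rw [inv_le_iff_one_le_mul₀ h1]
    nlinarith
  linarith

theorem exp_logUnit_sub_one_le {u k : ℝ} (hu : 0 < u) (hu' : u ≤ 1 / 10 ^ 6) (hk : 0 ≤ k)
    (hk' : k ≤ 150) : Real.exp (k * logUnit u) - 1 ≤ (k + 1 / 10) * u := by
  have hw := logUnit_le hu hu'
  have hw0 := logUnit_nonneg hu hu'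
  have hx0 : 0 ≤ k * logUnit u := by positivity
  have hx : k * logUnit u ≤ k * u + u / 50 := by nlinarith
  have hx2 : k * logUnit u ≤ 151 * u := by nlinarith
  have h := Real.abs_exp_sub_one_sub_id_le (x := k * logUnit u) (by rw [abs_of_nonneg hx0]; linarith)
  have h2 := (abs_le.mp h).2
  have h3 : (k * logUnit u) ^ 2 ≤ (151 * u) ^ 2 := by gcongr
  nlinarith

namespace RelClose

variable {u k k' x x' y y' z : ℝ}

theorem mono (hw : 0 ≤ logUnit u) (h : RelClose u k x y) (hk : k ≤ k') : RelClose u k' x y := by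
  obtain ⟨t, ht, rfl⟩ := h
  exact ⟨t, ht.trans (by gcongr), rfl⟩

theorem refl (hw : 0 ≤ logUnit u) (hk : 0 ≤ k) : RelClose u k x x :=
  ⟨0, by simpa using mul_nonneg hk hw, by simp⟩

theorem trans (h : RelClose u k x y) (h' : RelClose u k' y z) : RelClose u (k + k') x z := by
  obtain ⟨t, ht, rfl⟩ := h
  obtain ⟨t', ht', rfl⟩ := h'
  refine ⟨t' + t, ?_, by rw [Real.exp_add]; ring⟩
  have := abs_add_le t' t
  linarith

theorem symm (h : RelClose u k x y) : RelClose u k y x := by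
  obtain ⟨t, ht, rfl⟩ := h
  refine ⟨-t, by simpa using ht, ?_⟩
  rw [mul_assoc, ← Real.exp_add]; simp

theorem mul (h : RelClose u k x y) (h' : RelClose u k' x' y') :
    RelClose u (k + k') (x * x') (y * y') := by
  obtain ⟨t, ht, rfl⟩ := h
  obtain ⟨t', ht', rfl⟩ := h'
  refine ⟨t + t', ?_, by rw [Real.exp_add]; ring⟩
  have := abs_add_le t t'
  linarith

theorem inv (h : RelClose u k x y) : RelClose u k x⁻¹ y⁻¹ := by
  obtain ⟨t, ht, rfl⟩ := h
  exact ⟨-t, by simpa using ht, by rw [mul_inv, Real.exp_neg]⟩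

theorem div (h : RelClose u k x y) (h' : RelClose u k' x' y') :
    RelClose u (k + k') (x / x') (y / y') := by
  simpa [div_eq_mul_inv] using h.mul h'.inv

theorem neg (h : RelClose u k x y) : RelClose u k (-x) (-y) := by
  obtain ⟨t, ht, rfl⟩ := h
  exact ⟨t, ht, by ring⟩

theorem abs (h : RelClose u k x y) : RelClose u k |x| |y| := by
  obtain ⟨t, ht, rfl⟩ := h
  exact ⟨t, ht, by rw [abs_mul, abs_of_pos (Real.exp_pos t)]⟩

theorem sqrt (h : RelClose u k x y) : RelClose u (k / 2) √x √y := by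
  obtain ⟨t, ht, rfl⟩ := h
  refine ⟨t / 2, by rw [abs_div, abs_two]; linarith, ?_⟩
  rw [Real.sqrt_mul' _ (Real.exp_pos t).le, Real.exp_half]

theorem eq_zero_iff (h : RelClose u k x y) : x = 0 ↔ y = 0 := by
  obtain ⟨t, ht, rfl⟩ := h
  simp [Real.exp_ne_zero]

theorem nonneg (h : RelClose u k x y) (hy : 0 ≤ y) : 0 ≤ x := by
  obtain ⟨t, ht, rfl⟩ := h
  positivity

/-- The factor form and the two-sided bound agree. The nonnegativity of the tolerance is kept on both
sides, since for `y = 0` the factor form needs it. -/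
theorem iff_of_nonneg (hy : 0 ≤ y) : RelClose u k x y ∧ 0 ≤ k * logUnit u ↔
    y * Real.exp (-(k * logUnit u)) ≤ x ∧ x ≤ y * Real.exp (k * logUnit u) ∧
      0 ≤ k * logUnit u := by
  constructor
  · rintro ⟨⟨t, ht, rfl⟩, h0⟩
    have := abs_le.mp ht
    refine ⟨?_, ?_, h0⟩ <;> gcongr <;> linarith
  · rintro ⟨h1, h2, h0⟩
    refine ⟨?_, h0⟩
    rcases hy.eq_or_lt with rfl | hy
    · exact ⟨0, by simpa using h0, by linarith⟩
    · have hx : 0 < x := lt_of_lt_of_le (by positivity) h1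
      refine ⟨Real.log (x / y), abs_le.mpr ⟨?_, ?_⟩, ?_⟩
      · rw [Real.le_log_iff_exp_le (by positivity), le_div_iff₀ hy]; linarith
      · rw [Real.log_le_iff_le_exp (by positivity), div_le_iff₀ hy]; linarith
      · rw [Real.exp_log (by positivity)]; field_simp

theorem add_of_nonneg (hw : 0 ≤ k * logUnit u) (h : RelClose u k x y) (h' : RelClose u k x' y')
    (hy : 0 ≤ y) (hy' : 0 ≤ y') : RelClose u k (x + x') (y + y') := by
  have a := (iff_of_nonneg hy).1 ⟨h, hw⟩
  have b := (iff_of_nonneg hy').1 ⟨h', hw⟩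
  refine ((iff_of_nonneg (add_nonneg hy hy')).2 ⟨?_, ?_, hw⟩).1 <;> linarith

/-- A sum of terms of the same sign inherits the larger of the relative errors. -/
theorem add (hw : 0 ≤ logUnit u) (h : RelClose u k x y) (h' : RelClose u k' x' y')
    (hk : 0 ≤ k) (hy : 0 ≤ y * y') : RelClose u (max k k') (x + x') (y + y') := by
  have hw' : 0 ≤ max k k' * logUnit u := mul_nonneg (hk.trans (le_max_left _ _)) hw
  replace h := h.mono hw (le_max_left k k')
  replace h' := h'.mono hw (le_max_right k k')
  rcases mul_nonneg_iff.1 hy with ⟨h1, h2⟩ | ⟨h1, h2⟩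
  · exact add_of_nonneg hw' h h' h1 h2
  · have := (add_of_nonneg hw' h.neg h'.neg (by linarith) (by linarith)).neg
    convert this using 1 <;> ring

theorem round {e : ℝ} (hu : 0 < u) (hu' : u ≤ 1 / 10 ^ 6) (he : |e| ≤ u)
    (h : RelClose u k x y) : RelClose u (k + 1) (x * (1 + e)) y := by
  have he' := abs_le.mp he
  have : RelClose u 1 (x * (1 + e)) x := by
    refine ⟨Real.log (1 + e), ?_, by rw [Real.exp_log (by linarith)]⟩
    unfold logUnit
    rw [abs_le]
    constructor
    · have := Real.log_le_log (x := 1 - u) (y := 1 + e) (by linarith) (by linarith)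
      linarith
    · have : Real.log ((1 + e) * (1 - u)) ≤ 0 :=
        Real.log_nonpos (mul_nonneg (by linarith) (by linarith)) (by nlinarith)
      rw [Real.log_mul (by linarith) (by linarith)] at this
      linarith
  simpa [add_comm] using this.trans h

theorem of_abs_sub_le (hu : 0 < u) (hu' : u ≤ 1 / 10 ^ 6) (h : |x - y| ≤ u * |y|) :
    RelClose u 1 x y := by
  by_cases hy : y = 0
  · subst hy
    simp at h
    have hx : x = 0 := by linarith
    subst hx
    exact refl (logUnit_nonneg hu hu') zero_le_one
  · have := round (x := y) (y := y) (k := 0) (e := (x - y) / y) hu hu'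
      (by rw [abs_div, div_le_iff₀ (abs_pos.mpr hy)]; exact h)
      (refl (logUnit_nonneg hu hu') le_rfl)
    convert this using 1
    · ring
    · field_simp; ring

theorem nearBy (h : RelClose u k x y) (hk : 0 ≤ k * logUnit u) : NearBy u k x y |y| := by
  obtain ⟨t, ht, rfl⟩ := h
  refine ⟨?_, le_rfl⟩
  have : y * Real.exp t - y = (Real.exp t - 1) * y := by ring
  rw [this, abs_mul]
  gcongr
  have h1 := Real.exp_le_exp.mpr (abs_le.mp ht).2
  have h2 := Real.exp_le_exp.mpr (abs_le.mp ht).1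
  rw [Real.exp_neg] at h2
  have h3 := Real.one_le_exp hk
  rw [abs_le]
  refine ⟨?_, by linarith⟩
  have h4 : (Real.exp (k * logUnit u))⁻¹ ≥ 2 - Real.exp (k * logUnit u) := by
    rw [ge_iff_le, ← one_div, le_div_iff₀ (by positivity)]
    nlinarith [sq_nonneg (Real.exp (k * logUnit u) - 1)]
  linarith

end RelClose

namespace NearBy

variable {u k k' x x' y y' z z' : ℝ}

theorem mono (hw : 0 ≤ logUnit u) (h : NearBy u k x y z) (hk : k ≤ k') : NearBy u k' x y z := by
  refine ⟨h.1.trans ?_, h.2⟩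
  have := (abs_nonneg y).trans h.2
  gcongr

theorem abs_le_exp_mul (h : NearBy u k x y z) : |x| ≤ Real.exp (k * logUnit u) * z := by
  have h1 := h.1
  have h2 := h.2
  have := abs_add_le (x - y) y
  rw [sub_add_cancel] at this
  linarith

theorem mul (hw : 0 ≤ logUnit u) (hk : 0 ≤ k) (hk' : 0 ≤ k') (h : NearBy u k x y z)
    (h' : NearBy u k' x' y' z') : NearBy u (k + k') (x * x') (y * y') (z * z') := by
  have hz := (abs_nonneg y).trans h.2
  have hz' := (abs_nonneg y').trans h'.2
  have e1 : 1 ≤ Real.exp (k * logUnit u) := Real.one_le_exp (mul_nonneg hk hw)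
  have e2 : 1 ≤ Real.exp (k' * logUnit u) := Real.one_le_exp (mul_nonneg hk' hw)
  constructor
  · have h1 : x * x' - y * y' = (x - y) * x' + y * (x' - y') := by ring
    rw [h1]
    refine (abs_add_le _ _).trans ?_
    rw [abs_mul, abs_mul]
    have h2 : |x - y| * |x'| ≤ ((Real.exp (k * logUnit u) - 1) * z) *
        (Real.exp (k' * logUnit u) * z') :=
      mul_le_mul h.1 h'.abs_le_exp_mul (abs_nonneg _) ((abs_nonneg _).trans h.1)
    have h3 : |y| * |x' - y'| ≤ z * ((Real.exp (k' * logUnit u) - 1) * z') :=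
      mul_le_mul h.2 h'.1 (abs_nonneg _) hz
    rw [add_mul, Real.exp_add]
    linarith
  · rw [abs_mul]
    exact mul_le_mul h.2 h'.2 (abs_nonneg _) hz

theorem add (h : NearBy u k x y z) (h' : NearBy u k x' y' z') :
    NearBy u k (x + x') (y + y') (z + z') := by
  constructor
  · have h1 : x + x' - (y + y') = (x - y) + (x' - y') := by ring
    rw [h1]
    refine (abs_add_le _ _).trans ?_
    linarith [h.1, h'.1]
  · exact (abs_add_le _ _).trans (add_le_add h.2 h'.2)

theorem round {e : ℝ} (hu : 0 < u) (hu' : u ≤ 1 / 10 ^ 6) (hk : 0 ≤ k) (he : |e| ≤ u)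
    (h : NearBy u k x y z) : NearBy u (k + 1) (x * (1 + e)) y z := by
  have hw := logUnit_nonneg hu hu'
  have h1 : NearBy u 1 (1 + e) 1 1 := by
    have := ((RelClose.refl (x := 1) hw le_rfl).round hu hu' he).nearBy (by simpa using hw)
    simpa using this
  simpa using h.mul hw hk zero_le_one h1

theorem of_relClose (hw : 0 ≤ logUnit u) (hk : 0 ≤ k) (h : RelClose u k x y) :
    NearBy u k x y |y| := h.nearBy (mul_nonneg hk hw)

theorem refl (hw : 0 ≤ logUnit u) (hk : 0 ≤ k) : NearBy u k x x |x| :=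
  of_relClose hw hk (.refl hw hk)

end NearBy

namespace FloatModel

variable {u : ℝ} (fp : FloatModel u) {k k' a a' b b' z z' : ℝ}

theorem mul_zero (a : ℝ) : fp.mul a 0 = 0 := by
  obtain ⟨e, -, h⟩ := fp.mul_err a 0
  simpa using h

theorem zero_mul (a : ℝ) : fp.mul 0 a = 0 := by
  obtain ⟨e, -, h⟩ := fp.mul_err 0 a
  simpa using h

theorem add_zero_zero : fp.add 0 0 = 0 := by
  obtain ⟨e, -, h⟩ := fp.add_err 0 0
  simpa using h

theorem add_relClose (hu : 0 < u) (hu' : u ≤ 1 / 10 ^ 6) (hk : 0 ≤ k) (h : RelClose u k a a')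
    (h' : RelClose u k' b b') (hs : 0 ≤ a' * b') :
    RelClose u (max k k' + 1) (fp.add a b) (a' + b') := by
  obtain ⟨e, he, h0⟩ := fp.add_err a b
  rw [h0]
  exact (h.add (logUnit_nonneg hu hu') h' hk hs).round hu hu' he

theorem sub_relClose (hu : 0 < u) (hu' : u ≤ 1 / 10 ^ 6) (a b : ℝ) :
    RelClose u 1 (fp.sub a b) (a - b) := by
  obtain ⟨e, he, h0⟩ := fp.sub_err a b
  rw [h0]
  simpa using (RelClose.refl (logUnit_nonneg hu hu') le_rfl).round hu hu' he

theorem mul_relClose (hu : 0 < u) (hu' : u ≤ 1 / 10 ^ 6) (h : RelClose u k a a')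
    (h' : RelClose u k' b b') : RelClose u (k + k' + 1) (fp.mul a b) (a' * b') := by
  obtain ⟨e, he, h0⟩ := fp.mul_err a b
  rw [h0]
  exact (h.mul h').round hu hu' he

theorem div_relClose (hu : 0 < u) (hu' : u ≤ 1 / 10 ^ 6) (hb : b' ≠ 0) (h : RelClose u k a a')
    (h' : RelClose u k' b b') : RelClose u (k + k' + 1) (fp.div a b) (a' / b') := by
  obtain ⟨e, he, h0⟩ := fp.div_err a b (h'.eq_zero_iff.not.mpr hb)
  rw [h0]
  exact (h.div h').round hu hu' he

theorem sqrt_relClose (hu : 0 < u) (hu' : u ≤ 1 / 10 ^ 6) (ha : 0 ≤ a') (h : RelClose u k a a') :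
    RelClose u (k / 2 + 1) (fp.sqrt a) √a' := by
  obtain ⟨e, he, h0⟩ := fp.sqrt_err a (h.nonneg ha)
  rw [h0]
  exact h.sqrt.round hu hu' he

theorem add_nearBy (hu : 0 < u) (hu' : u ≤ 1 / 10 ^ 6) (hk : 0 ≤ k) (h : NearBy u k a a' z)
    (h' : NearBy u k b b' z') : NearBy u (k + 1) (fp.add a b) (a' + b') (z + z') := by
  obtain ⟨e, he, h0⟩ := fp.add_err a b
  rw [h0]
  exact (h.add h').round hu hu' hk he

theorem mul_nearBy (hu : 0 < u) (hu' : u ≤ 1 / 10 ^ 6) (hk : 0 ≤ k) (hk' : 0 ≤ k')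
    (h : NearBy u k a a' z) (h' : NearBy u k' b b' z') :
    NearBy u (k + k' + 1) (fp.mul a b) (a' * b') (z * z') := by
  obtain ⟨e, he, h0⟩ := fp.mul_err a b
  rw [h0]
  exact (h.mul (logUnit_nonneg hu hu') hk hk' h').round hu hu' (by positivity) he

/-- Entrywise forward error of a computed `2 × 2` product. -/
theorem mulM_nearBy (hu : 0 < u) (hu' : u ≤ 1 / 10 ^ 6) (hk : 0 ≤ k) (hk' : 0 ≤ k')
    {X X' Xh Y Y' Yh : Mat2} (hX : ∀ i j, NearBy u k (X i j) (X' i j) (Xh i j))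
    (hY : ∀ i j, NearBy u k' (Y i j) (Y' i j) (Yh i j)) (i j : Fin 2) :
    NearBy u (k + k' + 2) (fp.mulM X Y i j) ((X' * Y') i j) ((Xh * Yh) i j) := by
  have := fp.add_nearBy hu hu' (by positivity)
    (fp.mul_nearBy hu hu' hk hk' (hX i 0) (hY 0 j)) (fp.mul_nearBy hu hu' hk hk' (hX i 1) (hY 1 j))
  simp only [Matrix.mul_apply, Fin.sum_univ_two, mulM, Matrix.of_apply]
  convert this using 1
  ring

end FloatModel

/-! ### Computed rotations -/

/-- `xLARTG` is componentwise accurate. -/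
theorem FloatModel.lartg_relClose {u : ℝ} (hu : 0 < u) (hu' : u ≤ 1 / 10 ^ 6) (fp : FloatModel u)
    (f g : ℝ) : ∃ c s : ℝ, c ^ 2 + s ^ 2 = 1 ∧ f * s = g * c ∧
      RelClose u 3 (fp.lartg f g).1 c ∧ RelClose u 3 (fp.lartg f g).2 s := by
  have hw := logUnit_nonneg hu hu'
  have R0 : ∀ x, RelClose u 0 x x := fun x => .refl hw le_rfl
  unfold FloatModel.lartg
  split_ifs with h1 h2
  · exact ⟨1, 0, by norm_num, by simp [h1], .refl hw (by norm_num), .refl hw (by norm_num)⟩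
  · exact ⟨0, 1, by norm_num, by simp [h2], .refl hw (by norm_num), .refl hw (by norm_num)⟩
  · set r := fp.sqrt (fp.add (fp.mul f f) (fp.mul g g)) with hr
    have hpos : 0 < f * f + g * g := by
      have := mul_self_pos.mpr h1
      have := mul_self_nonneg f
      linarith
    have hρ : 0 < √(f * f + g * g) := Real.sqrt_pos.mpr hpos
    have hρ2 : √(f * f + g * g) ^ 2 = f * f + g * g := Real.sq_sqrt hpos.le
    have hrel : RelClose u 2 r √(f * f + g * g) :=
      (fp.sqrt_relClose hu hu' hpos.le (fp.add_relClose hu hu' (by norm_num)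
        (fp.mul_relClose hu hu' (R0 f) (R0 f)) (fp.mul_relClose hu hu' (R0 g) (R0 g))
        (mul_nonneg (mul_self_nonneg f) (mul_self_nonneg g)))).mono hw (by norm_num)
    have hc : RelClose u 3 (fp.div f r) (f / √(f * f + g * g)) :=
      (fp.div_relClose hu hu' hρ.ne' (R0 f) hrel).mono hw (by norm_num)
    have hs : RelClose u 3 (fp.div g r) (g / √(f * f + g * g)) :=
      (fp.div_relClose hu hu' hρ.ne' (R0 g) hrel).mono hw (by norm_num)
    have hone : (f / √(f * f + g * g)) ^ 2 + (g / √(f * f + g * g)) ^ 2 = 1 := by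
      rw [div_pow, div_pow, hρ2]
      field_simp
    dsimp only
    split_ifs with h3
    · refine ⟨-(f / √(f * f + g * g)), -(g / √(f * f + g * g)), ?_, by ring, hc.neg, hs.neg⟩
      rw [neg_sq, neg_sq, hone]
    · exact ⟨_, _, hone, by ring, hc, hs⟩

/-- `(cl, sl)` and `(cr, sr)` are the left and right rotations of an unnormalized SVD of
`[f g; 0 h]`; the second diagonal entry of the result vanishes if the matrix is singular. -/
structure IsSVDRotation (f g h cl sl cr sr : ℝ) : Prop where
  left : cl ^ 2 + sl ^ 2 = 1
  right : cr ^ 2 + sr ^ 2 = 1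
  off₁ : cl * (g * cr - f * sr) + sl * (h * cr) = 0
  off₂ : -sl * (f * cr + g * sr) + cl * (h * sr) = 0
  diag₂ : f = 0 ∨ h = 0 → -sl * (g * cr - f * sr) + cl * (h * cr) = 0

/-- Reversing the order of rows and columns and transposing exchanges the two rotations. -/
theorem IsSVDRotation.swap {f g h cl sl cr sr : ℝ} (H : IsSVDRotation f g h cl sl cr sr) :
    IsSVDRotation h g f sr cr sl cl where
  left := by linarith [H.right]
  right := by linarith [H.left]
  off₁ := by linarith [H.off₂]
  off₂ := by linarith [H.off₁]
  diag₂ := fun h' => by linarith [H.diag₂ h'.symm]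

theorem IsSVDRotation.neg_right {f g h cl sl cr sr : ℝ} (H : IsSVDRotation f g h cl sl cr sr) :
    IsSVDRotation f g h cl sl (-cr) (-sr) where
  left := H.left
  right := by linarith [H.right]
  off₁ := by linarith [H.off₁]
  off₂ := by linarith [H.off₂]
  diag₂ := fun h' => by linarith [H.diag₂ h']

/-- `t ↦ 2 / √(t² + 4)` does not amplify relative errors. -/
theorem RelClose.two_div_sqrt {u k x y : ℝ} (hw : 0 ≤ logUnit u) (hk : 0 ≤ k)
    (h : RelClose u k x y) : RelClose u k (2 / √(x * x + 4)) (2 / √(y * y + 4)) := by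
  have h1 := ((h.mul h).add hw (RelClose.refl (x := 4) hw le_rfl) (by positivity)
    (mul_nonneg (mul_self_nonneg y) (by norm_num))).sqrt
  refine ((RelClose.refl hw le_rfl).div h1).mono hw ?_
  rw [max_eq_left (by linarith)]
  linarith

/-- `t ↦ t / √(t² + 4)` does not amplify relative errors. -/
theorem RelClose.div_sqrt {u k x y : ℝ} (hw : 0 ≤ logUnit u) (hk : 0 ≤ k)
    (h : RelClose u k x y) : RelClose u k (x / √(x * x + 4)) (y / √(y * y + 4)) := by
  obtain ⟨t, ht, rfl⟩ := h
  -- divide numerator and denominator by `exp t`, which moves the error to the constant `4`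
  have h1 : y * Real.exp t / √(y * Real.exp t * (y * Real.exp t) + 4) =
      y / √(y * y + 4 * Real.exp (-(2 * t))) := by
    have h2 : y * Real.exp t * (y * Real.exp t) + 4 =
        (y * y + 4 * Real.exp (-(2 * t))) * Real.exp (2 * t) := by
      rw [add_mul, mul_assoc 4, ← Real.exp_add, neg_add_cancel, Real.exp_zero, two_mul,
        Real.exp_add]
      ring
    rw [h2, Real.sqrt_mul' _ (Real.exp_pos _).le, ← Real.exp_half, mul_div_cancel_left₀ _ two_ne_zero,
      mul_div_mul_right _ _ (Real.exp_pos t).ne']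
  rw [h1]
  have h3 : RelClose u (2 * k) (4 * Real.exp (-(2 * t))) 4 :=
    ⟨-(2 * t), by rw [abs_neg, abs_mul, abs_two]; linarith, rfl⟩
  have h4 := ((RelClose.refl (x := y * y) hw le_rfl).add hw h3 le_rfl
    (mul_nonneg (mul_self_nonneg y) (by norm_num))).sqrt
  refine ((RelClose.refl hw le_rfl).div h4).mono hw ?_
  rw [max_eq_right (by linarith)]
  linarith

section ExactFormulas

variable {m p : ℝ}

/-- The largest singular value of `[1 m; 0 ±p]` for `0 ≤ p ≤ 1`, in the form used by `xLASV2`. -/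
noncomputable def svdA (m p : ℝ) : ℝ :=
  1 / 2 * (√((2 - (1 - p)) * (2 - (1 - p)) + m * m) + √((1 - p) * (1 - p) + m * m))

/-- Twice the tangent of the right rotation angle for `[1 m; 0 ±p]`, in the form used by
`xLASV2`. -/
noncomputable def svdT (m p : ℝ) : ℝ :=
  (m / (√((2 - (1 - p)) * (2 - (1 - p)) + m * m) + (2 - (1 - p))) +
    m / (√((1 - p) * (1 - p) + m * m) + (1 - p))) * (1 + svdA m p)

/-- The square of the largest singular value lies between `1 + m²` and `1 + m² + p²` and is a root of
the characteristic polynomial of `MᵀM`; rationalizing the fractions in `svdT` gives its closed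
form. -/
theorem svdA_facts (hp : 0 ≤ p) (hp1 : p ≤ 1) (hm : m ≠ 0) :
    0 < svdA m p ∧ 1 + m ^ 2 ≤ svdA m p ^ 2 ∧ svdA m p ^ 2 ≤ 1 + m ^ 2 + p ^ 2 ∧
      (svdA m p ^ 2 - m ^ 2 - p ^ 2) * (svdA m p ^ 2 - 1) = m ^ 2 ∧
      svdT m p * m = 2 * (svdA m p ^ 2 - 1) := by
  have hm2 : 0 < m * m := mul_self_pos.mpr hm
  unfold svdT svdA
  set l := 1 - p with hl
  have hl0 : 0 ≤ l := by linarith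
  have ht0 : 0 < 2 - l := by linarith
  have hS : 0 < (2 - l) * (2 - l) + m * m := by positivity
  have hR : 0 < l * l + m * m := by positivity
  have hs := Real.sq_sqrt hS.le
  have hr := Real.sq_sqrt hR.le
  have hs0 := Real.sqrt_pos.mpr hS
  have hr0 := Real.sqrt_pos.mpr hR
  set s := √((2 - l) * (2 - l) + m * m)
  set r := √(l * l + m * m)
  have hpl : p = 1 - l := by linarith
  have hsr2 : (s * r) ^ 2 = (1 + m ^ 2 + p ^ 2) ^ 2 - 4 * p ^ 2 := by
    rw [mul_pow, hs, hr, hpl]; ring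
  have hsr0 : 0 < s * r := by positivity
  have ha2 : (1 / 2 * (s + r)) ^ 2 = (1 + m ^ 2 + p ^ 2 + s * r) / 2 := by
    have : (1 / 2 * (s + r)) ^ 2 = (s ^ 2 + r ^ 2 + 2 * (s * r)) / 4 := by ring
    rw [this, hs, hr, hpl]; ring
  refine ⟨by positivity, ?_, ?_, ?_, ?_⟩
  · rw [ha2]
    have : 1 + m ^ 2 - p ^ 2 ≤ s * r := by
      refine le_of_sq_le_sq ?_ hsr0.le
      rw [hsr2]
      nlinarith [mul_nonneg (sq_nonneg m) (sq_nonneg p)]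
    linarith
  · rw [ha2]
    have : s * r ≤ 1 + m ^ 2 + p ^ 2 := by
      refine le_of_sq_le_sq ?_ (by positivity)
      rw [hsr2]
      nlinarith [sq_nonneg p]
    linarith
  · rw [ha2]
    linear_combination hsr2 / 4
  · have h1 : m / (s + (2 - l)) * m = s - (2 - l) := by
      field_simp
      linear_combination -hs
    have h2 : m / (r + l) * m = r - l := by
      have : r + l ≠ 0 := by positivity
      field_simp
      linear_combination -hr
    linear_combination (1 + 1 / 2 * (s + r)) * (h1 + h2)

/-- The exact values computed by `xLASV2` are the rotations of an SVD of `[f g; 0 h]`. -/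
theorem isSVDRotation_formulas {f g h : ℝ} (hf : f ≠ 0) (hg : g ≠ 0) (hfh : |h| ≤ |f|) :
    IsSVDRotation f g h
      ((2 / √(svdT (g / f) (|h| / |f|) * svdT (g / f) (|h| / |f|) + 4) +
          svdT (g / f) (|h| / |f|) /
            √(svdT (g / f) (|h| / |f|) * svdT (g / f) (|h| / |f|) + 4) * (g / f)) /
        svdA (g / f) (|h| / |f|))
      (h / f * (svdT (g / f) (|h| / |f|) /
            √(svdT (g / f) (|h| / |f|) * svdT (g / f) (|h| / |f|) + 4)) /
        svdA (g / f) (|h| / |f|))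
      (2 / √(svdT (g / f) (|h| / |f|) * svdT (g / f) (|h| / |f|) + 4))
      (svdT (g / f) (|h| / |f|) / √(svdT (g / f) (|h| / |f|) * svdT (g / f) (|h| / |f|) + 4)) := by
  have hm : g / f ≠ 0 := div_ne_zero hg hf
  obtain ⟨ha0, -, -, hchar, hT⟩ := svdA_facts (m := g / f) (p := |h| / |f|) (by positivity)
    (div_le_one_of_le₀ hfh (abs_nonneg f)) hm
  have hp2 : (|h| / |f|) ^ 2 = (h / f) ^ 2 := by rw [div_pow, div_pow, sq_abs, sq_abs]
  rw [hp2] at hchar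
  set a := svdA (g / f) (|h| / |f|)
  set T := svdT (g / f) (|h| / |f|)
  have hgm : g = f * (g / f) := by field_simp
  have hhρ : h = f * (h / f) := by field_simp
  set m := g / f
  set ρ := h / f
  have hL : 0 < T * T + 4 := by nlinarith [mul_self_nonneg T]
  have hL2 := Real.sq_sqrt hL.le
  have hL0 := Real.sqrt_pos.mpr hL
  set L := √(T * T + 4)
  have hright : (2 / L) ^ 2 + (T / L) ^ 2 = 1 := by
    rw [div_pow, div_pow, hL2, ← add_div, div_eq_one_iff_eq hL.ne']; ring
  -- the two components of the eigenvector equation `MᵀM x = a² x` for `M = [1 m; 0 ρ]`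
  have e1 : 2 / L + T / L * m = a ^ 2 * (2 / L) := by
    have : 2 / L + T / L * m = (2 + T * m) / L := by ring
    rw [this, hT]; ring
  have e2 : m * (2 / L) + (m ^ 2 + ρ ^ 2) * (T / L) = a ^ 2 * (T / L) := by
    have h1 : (m ^ 2 + ρ ^ 2) * T + 2 * m = a ^ 2 * T := by
      apply mul_right_cancel₀ hm
      linear_combination (m ^ 2 + ρ ^ 2 - a ^ 2) * hT - 2 * hchar
    have h2 : m * (2 / L) + (m ^ 2 + ρ ^ 2) * (T / L) =
      ((m ^ 2 + ρ ^ 2) * T + 2 * m) / L := by ring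
    rw [h2, h1]; ring
  have ecl : (2 / L + T / L * m) / a = a * (2 / L) := by rw [e1]; field_simp
  rw [ecl]
  rw [hgm, hhρ]
  clear_value a m ρ
  generalize 2 / L = x at *
  generalize T / L = y at *
  refine ⟨?_, hright, ?_, ?_, ?_⟩
  · field_simp
    linear_combination a ^ 2 * hright - (a ^ 2 * x + m * y) * e1 + y * e2
  · field_simp
    linear_combination f * x * (e2 - m * e1)
  · field_simp
    linear_combination -f * ρ * y * e1
  · rintro (h0 | h0)
    · exact absurd h0 hf
    · have : ρ = 0 := (mul_eq_zero.mp h0).resolve_left hf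
      simp [this]

end ExactFormulas

/-- `l ↦ 2 - l` at most doubles relative errors on `[0, 1]`. -/
theorem RelClose.two_sub {u k x y : ℝ} (hw : 0 ≤ k * logUnit u) (hw' : k * logUnit u ≤ 1 / 4)
    (h : RelClose u k x y) (hy : 0 ≤ y) (hy1 : y ≤ 1) : RelClose u (2 * k) (2 - x) (2 - y) := by
  obtain ⟨h1, h2, -⟩ := (iff_of_nonneg hy).1 ⟨h, hw⟩
  refine ((iff_of_nonneg (by linarith)).2 ⟨?_, ?_, by linarith⟩).1
  all_goals
    have hE : Real.exp (2 * k * logUnit u) = Real.exp (k * logUnit u) ^ 2 := by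
      rw [← Real.exp_nat_mul]; congr 1; push_cast; ring
    have hE1 := Real.one_le_exp hw
    have hE2 : Real.exp (k * logUnit u) ≤ 3 / 2 := by
      have := Real.exp_bound_div_one_sub_of_interval hw (by linarith)
      refine this.trans ?_
      rw [div_le_iff₀ (by linarith)]; linarith
    rw [Real.exp_neg] at *
    rw [hE]
    set E := Real.exp (k * logUnit u)
    have hE0 : 0 < E := by linarith
  · rw [← div_eq_mul_inv, div_le_iff₀ (by positivity)]
    have h3 : (2 - y * E) * E ^ 2 ≤ (2 - x) * E ^ 2 := by gcongr
    refine le_trans ?_ h3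
    nlinarith [mul_nonneg hy (mul_nonneg (sub_nonneg.2 hE1) (by nlinarith : 0 ≤ 1 + E + E ^ 2)),
      mul_nonneg (sub_nonneg.2 hy1) (mul_nonneg (sub_nonneg.2 hE1)
        (by nlinarith : 0 ≤ 1 + E + E ^ 2)),
      mul_nonneg (sub_nonneg.2 hE1) (by nlinarith : 0 ≤ 1 + E - E ^ 2)]
  · have h3 : y * (1 - (E - 1)) ≤ y * E⁻¹ := by
      gcongr
      rw [← one_div, le_div_iff₀ hE0]
      nlinarith [sq_nonneg (E - 1)]
    nlinarith

/-- Componentwise accuracy of the generic part of `xLASV2`. -/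
theorem FloatModel.lasv2Core_relClose {u : ℝ} (hu : 0 < u) (hu' : u ≤ 1 / 10 ^ 6)
    (fp : FloatModel u) {f g h : ℝ} (hf : f ≠ 0) (hg : g ≠ 0) (hfh : |h| ≤ |f|) :
    ∃ cl sl cr sr : ℝ, IsSVDRotation f g h cl sl cr sr ∧
      RelClose u 40 (fp.lasv2Core f g h).1.1 cl ∧ RelClose u 40 (fp.lasv2Core f g h).1.2 sl ∧
      RelClose u 40 (fp.lasv2Core f g h).2.1 cr ∧ RelClose u 40 (fp.lasv2Core f g h).2.2 sr := by
  refine ⟨_, _, _, _, isSVDRotation_formulas hf hg hfh, ?_⟩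
  have hw := logUnit_nonneg hu hu'
  have hw' := logUnit_le hu hu'
  have R0 : ∀ x, RelClose u 0 x x := fun x => .refl hw le_rfl
  have hf0 : 0 < |f| := abs_pos.mpr hf
  have hm : g / f ≠ 0 := div_ne_zero hg hf
  have hp0 : 0 ≤ |h| / |f| := by positivity
  have hp1 : |h| / |f| ≤ 1 := div_le_one_of_le₀ hfh (abs_nonneg f)
  obtain ⟨ha0, ha1, -, -, hT⟩ := svdA_facts hp0 hp1 hm
  have hTm : 0 ≤ svdT (g / f) (|h| / |f|) * (g / f) := by nlinarith [sq_nonneg (g / f)]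
  have ha := svdA.eq_1 (g / f) (|h| / |f|)
  have hTd := svdT.eq_1 (g / f) (|h| / |f|)
  unfold FloatModel.lasv2Core
  dsimp only
  have hmF : RelClose u 1 (fp.div g f) (g / f) :=
    (fp.div_relClose hu hu' hf (R0 g) (R0 f)).mono hw (by norm_num)
  have hdF := fp.sub_relClose hu hu' |f| |h|
  generalize fp.sub |f| |h| = dF at *
  have hl : (|f| - |h|) / |f| = 1 - |h| / |f| := by field_simp
  have hlF : RelClose u 2 (if dF = |f| then 1 else fp.div dF |f|) (1 - |h| / |f|) := by
    rw [← hl]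
    split_ifs with hd
    · rw [hd] at hdF
      have := hdF.div (R0 |f|)
      rw [div_self hf0.ne'] at this
      exact this.mono hw (by norm_num)
    · exact (fp.div_relClose hu hu' hf0.ne' hdF (R0 |f|)).mono hw (by norm_num)
  generalize (if dF = |f| then 1 else fp.div dF |f|) = lF at *
  have hl0 : 0 ≤ 1 - |h| / |f| := by linarith
  have hl1 : 1 - |h| / |f| ≤ 1 := by linarith
  have htF : RelClose u 5 (fp.sub 2 lF) (2 - (1 - |h| / |f|)) :=
    ((fp.sub_relClose hu hu' 2 lF).trans (hlF.two_sub (by positivity) (by linarith) hl0 hl1)).mono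
      hw (by norm_num)
  generalize fp.sub 2 lF = tF at *
  generalize fp.div g f = mF at *
  have hm2 : 0 < g / f * (g / f) := mul_self_pos.mpr hm
  have hmmF : RelClose u 3 (fp.mul mF mF) (g / f * (g / f)) :=
    (fp.mul_relClose hu hu' hmF hmF).mono hw (by norm_num)
  generalize fp.mul mF mF = mmF at *
  -- without underflow, the square of `m` is not zero
  rw [if_neg (hmmF.eq_zero_iff.not.mpr hm2.ne')]
  generalize g / f = m at *
  have hl1' : |h| / |f| = 1 - (1 - |h| / |f|) := by ring
  generalize 1 - |h| / |f| = l at *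
  have ht0 : 0 < 2 - l := by linarith
  have hsF : RelClose u 7 (fp.sqrt (fp.add (fp.mul tF tF) mmF)) √((2 - l) * (2 - l) + m * m) :=
    (fp.sqrt_relClose hu hu' (by positivity) (fp.add_relClose hu hu' (by norm_num)
      (fp.mul_relClose hu hu' htF htF) hmmF (by positivity))).mono hw (by norm_num)
  have hs0 : 0 < √((2 - l) * (2 - l) + m * m) := Real.sqrt_pos.mpr (by positivity)
  generalize fp.sqrt (fp.add (fp.mul tF tF) mmF) = sF at *
  generalize √((2 - l) * (2 - l) + m * m) = s at *
  have hrF : RelClose u 4 (if lF = 0 then |mF| else fp.sqrt (fp.add (fp.mul lF lF) mmF))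
      √(l * l + m * m) := by
    split_ifs with h0
    · rw [hlF.eq_zero_iff] at h0
      rw [h0, MulZeroClass.mul_zero, zero_add, Real.sqrt_mul_self_eq_abs]
      exact hmF.abs.mono hw (by norm_num)
    · exact (fp.sqrt_relClose hu hu' (by positivity) (fp.add_relClose hu hu' (by norm_num)
        (fp.mul_relClose hu hu' hlF hlF) hmmF (by positivity))).mono hw (by norm_num)
  have hr0 : 0 < √(l * l + m * m) := Real.sqrt_pos.mpr (by positivity)
  generalize (if lF = 0 then |mF| else fp.sqrt (fp.add (fp.mul lF lF) mmF)) = rF at *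
  generalize √(l * l + m * m) = r at *
  have haF : RelClose u 9 (fp.mul (1 / 2) (fp.add sF rF)) (svdA m (|h| / |f|)) := by
    rw [ha]
    exact (fp.mul_relClose hu hu' (R0 _) (fp.add_relClose hu hu' (by norm_num) hsF hrF
      (by positivity))).mono hw (by norm_num)
  generalize fp.mul (1 / 2) (fp.add sF rF) = aF at *
  generalize svdA m (|h| / |f|) = a at *
  have hTF : RelClose u 22
      (fp.mul (fp.add (fp.div mF (fp.add sF tF)) (fp.div mF (fp.add rF lF))) (fp.add 1 aF))
      (svdT m (|h| / |f|)) := by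
    rw [hTd]
    have h1 := fp.div_relClose hu hu' (by positivity) hmF
      (fp.add_relClose hu hu' (by norm_num) hsF htF (by positivity))
    have h2 := fp.div_relClose hu hu' (by positivity) hmF
      (fp.add_relClose hu hu' (by norm_num) hrF hlF (by positivity))
    refine (fp.mul_relClose hu hu' (fp.add_relClose hu hu' (by norm_num) h1 h2 ?_)
      (fp.add_relClose hu hu' le_rfl (R0 1) haF (by linarith))).mono hw (by norm_num)
    rw [div_mul_div_comm]
    positivity
  generalize (fp.mul (fp.add (fp.div mF (fp.add sF tF)) (fp.div mF (fp.add rF lF)))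
    (fp.add 1 aF)) = TF at *
  generalize svdT m (|h| / |f|) = T at *
  have hLF : RelClose u 2 (fp.sqrt (fp.add (fp.mul TF TF) 4)) √(TF * TF + 4) :=
    (fp.sqrt_relClose hu hu' (by nlinarith) (fp.add_relClose hu hu' (by norm_num)
      (fp.mul_relClose hu hu' (R0 TF) (R0 TF)) (R0 4) (by nlinarith))).mono hw (by norm_num)
  generalize fp.sqrt (fp.add (fp.mul TF TF) 4) = LF at *
  have hLF0 : 0 < √(TF * TF + 4) := Real.sqrt_pos.mpr (by nlinarith)
  have hL0 : 0 < √(T * T + 4) := Real.sqrt_pos.mpr (by nlinarith)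
  have hcr : RelClose u 25 (fp.div 2 LF) (2 / √(T * T + 4)) :=
    ((fp.div_relClose hu hu' hLF0.ne' (R0 2) hLF).trans
      (hTF.two_div_sqrt hw (by norm_num))).mono hw (by norm_num)
  have hsr : RelClose u 25 (fp.div TF LF) (T / √(T * T + 4)) :=
    ((fp.div_relClose hu hu' hLF0.ne' (R0 TF) hLF).trans
      (hTF.div_sqrt hw (by norm_num))).mono hw (by norm_num)
  refine ⟨?_, ?_, hcr.mono hw (by norm_num), hsr.mono hw (by norm_num)⟩
  · refine (fp.div_relClose hu hu' ha0.ne' (fp.add_relClose hu hu' (by norm_num) hcr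
      (fp.mul_relClose hu hu' hsr hmF) ?_) haF).mono hw (by norm_num)
    refine mul_nonneg (by positivity) ?_
    rw [div_mul_eq_mul_div]
    exact div_nonneg hTm hL0.le
  · exact (fp.div_relClose hu hu' ha0.ne' (fp.mul_relClose hu hu'
      (fp.div_relClose hu hu' hf (R0 h) (R0 f)) hsr) haF).mono hw (by norm_num)

/-- For a matrix `[1 m; 0 ±p]` with huge `|m|`, the exact values are within a few roundings of the
simplified ones that `xLASV2` returns in that case. -/
theorem svd_formulas_of_large {u : ℝ} (hu : 0 < u) (hu' : u ≤ 1 / 10 ^ 6) {m p : ℝ} (hp : 0 ≤ p)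
    (hp1 : p ≤ 1) (hm : 1 ≤ 2 * u * |m|) :
    RelClose u 2 (2 / √(svdT m p * svdT m p + 4)) (1 / |m|) ∧
      RelClose u 1 (svdT m p / √(svdT m p * svdT m p + 4)) (m / |m|) ∧
      RelClose u 1 (svdA m p) |m| ∧
      RelClose u 4 ((2 / √(svdT m p * svdT m p + 4) +
        svdT m p / √(svdT m p * svdT m p + 4) * m) / svdA m p) 1 := by
  have hw := logUnit_nonneg hu hu'
  have hm0 : 0 < |m| := by
    by_contra h
    have : |m| ≤ 0 := not_lt.mp h
    nlinarith
  have hmne : m ≠ 0 := abs_pos.mp hm0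
  obtain ⟨ha0, ha1, ha2, -, hT⟩ := svdA_facts hp hp1 hmne
  generalize svdA m p = a at *
  generalize svdT m p = T at *
  rw [← sq_abs m] at ha1 ha2
  have hum : 10 ≤ u * |m| ^ 2 := by nlinarith
  have hp2 : p ^ 2 ≤ 1 := by nlinarith
  have hTm : 0 < T * m := by nlinarith
  have hT0 : 0 < |T| := abs_pos.mpr (left_ne_zero_of_mul hTm.ne')
  have hTabs : |T| * |m| = 2 * (a ^ 2 - 1) := by rw [← abs_mul, abs_of_pos hTm, hT]
  have hsign : T / |T| = m / |m| := by
    rw [div_eq_div_iff hT0.ne' hm0.ne']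
    rcases abs_cases T with ⟨h1, h1'⟩ | ⟨h1, h1'⟩ <;> rcases abs_cases m with ⟨h2, h2'⟩ | ⟨h2, h2'⟩ <;>
      rw [h1, h2] <;> nlinarith
  have hT2 : RelClose u 1 |T| (2 * |m|) := by
    refine .of_abs_sub_le hu hu' ?_
    rw [abs_of_pos (by positivity : 0 < 2 * |m|)]
    refine le_of_mul_le_mul_right ?_ hm0
    rw [← abs_of_pos hm0, ← abs_mul, sub_mul, abs_abs, hTabs, abs_of_nonneg] <;> nlinarith
  have hTm2 : 2 * |m| ≤ |T| := by
    refine le_of_mul_le_mul_right ?_ hm0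
    nlinarith
  have hTT : 40 ≤ u * (T * T) := by
    rw [← abs_mul_abs_self T]
    have : 2 * |m| * (2 * |m|) ≤ |T| * |T| := by gcongr
    nlinarith
  have hL : RelClose u (1 / 2) √(T * T + 4) |T| := by
    rw [← Real.sqrt_mul_self_eq_abs]
    refine RelClose.sqrt (.of_abs_sub_le hu hu' ?_)
    rw [abs_of_nonneg (mul_self_nonneg T), abs_of_nonneg] <;> linarith
  have hcr : RelClose u 2 (2 / √(T * T + 4)) (1 / |m|) := by
    have := (RelClose.refl (x := 2) hw le_rfl).div (hL.trans hT2)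
    convert this.mono (k' := 2) hw (by norm_num) using 1
    field_simp
  have hsr : RelClose u 1 (T / √(T * T + 4)) (m / |m|) := by
    rw [← hsign]
    exact ((RelClose.refl hw le_rfl).div hL).mono hw (by norm_num)
  have ha : RelClose u 1 a |m| := by
    have : RelClose u 1 (a ^ 2) (|m| ^ 2) := by
      refine .of_abs_sub_le hu hu' ?_
      rw [abs_of_nonneg (by linarith : (0 : ℝ) ≤ a ^ 2 - |m| ^ 2), abs_of_nonneg (sq_nonneg |m|)]
      linarith
    have := this.sqrt
    rw [Real.sqrt_sq ha0.le, Real.sqrt_sq hm0.le] at this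
    exact this.mono hw (by norm_num)
  refine ⟨hcr, hsr, ha, ?_⟩
  have hmm : m / |m| * m = |m| := by
    rw [div_mul_eq_mul_div, ← abs_mul_abs_self m]; field_simp
  have h1 := hcr.add hw (hsr.mul (.refl (x := m) hw le_rfl)) (by norm_num)
    (by rw [hmm]; positivity)
  rw [hmm] at h1
  have h2 : RelClose u 1 (1 / |m| + |m|) |m| := by
    refine .of_abs_sub_le hu hu' ?_
    rw [add_sub_cancel_right, abs_abs, abs_of_pos (by positivity), div_le_iff₀ hm0]
    nlinarith
  have h3 := (h1.trans h2).div ha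
  rw [div_self hm0.ne'] at h3
  exact h3.mono hw (by norm_num)

/-- Componentwise accuracy of `xLASV2`: the computed rotations are those of an exact SVD up to
40 roundings in every component. -/
theorem FloatModel.lasv2_relClose {u : ℝ} (hu : 0 < u) (hu' : u ≤ 1 / 10 ^ 6)
    (fp : FloatModel u) (f g h : ℝ) :
    ∃ cl sl cr sr : ℝ, IsSVDRotation f g h cl sl cr sr ∧
      RelClose u 40 (fp.lasv2 f g h).1.1 cl ∧ RelClose u 40 (fp.lasv2 f g h).1.2 sl ∧
      RelClose u 40 (fp.lasv2 f g h).2.1 cr ∧ RelClose u 40 (fp.lasv2 f g h).2.2 sr := by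
  have hw := logUnit_nonneg hu hu'
  have R0 : ∀ x, RelClose u 0 x x := fun x => .refl hw le_rfl
  have R40 : ∀ x, RelClose u 40 x x := fun x => .refl hw (by norm_num)
  -- the case `|h| ≤ |f|`, to which the other one is reduced by exchanging rows and columns
  have key : ∀ f h : ℝ, |h| ≤ |f| → ∃ cl sl cr sr : ℝ, IsSVDRotation f g h cl sl cr sr ∧
      ∀ r : (ℝ × ℝ) × (ℝ × ℝ), r = (if g = 0 then ((1, 0), (1, 0))
        else if |f| < |g| ∧ fp.div |f| |g| < u then ((1, fp.div h g), (fp.div f g, 1))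
        else fp.lasv2Core f g h) →
      RelClose u 40 r.1.1 cl ∧ RelClose u 40 r.1.2 sl ∧
      RelClose u 40 r.2.1 cr ∧ RelClose u 40 r.2.2 sr := by
    intro f h hfh
    by_cases hg : g = 0
    · refine ⟨1, 0, 1, 0, ⟨by norm_num, by norm_num, by simp [hg], by simp, ?_⟩, ?_⟩
      · rintro (rfl | rfl)
        · have : h = 0 := by simpa using hfh
          simp [this]
        · simp
      · rintro r rfl
        rw [if_pos hg]
        exact ⟨R40 _, R40 _, R40 _, R40 _⟩
    rw [if_neg hg]
    have hdh : RelClose u 1 (fp.div h g) (h / g) :=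
      (fp.div_relClose hu hu' hg (R0 h) (R0 g)).mono hw (by norm_num)
    have hdf : RelClose u 1 (fp.div f g) (f / g) :=
      (fp.div_relClose hu hu' hg (R0 f) (R0 g)).mono hw (by norm_num)
    by_cases hf : f = 0
    · have hh : h = 0 := by simpa [hf] using hfh
      subst hf hh
      have hlt : fp.div |0| |g| < u := by
        have := fp.div_relClose hu hu' (abs_ne_zero.mpr hg) (R0 |0|) (R0 |g|)
        rw [abs_zero, zero_div] at this
        rw [abs_zero, this.eq_zero_iff.mpr rfl]
        exact hu
      rw [if_pos ⟨by simpa using hg, hlt⟩]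
      refine ⟨1, 0, 0, 1, ⟨by norm_num, by norm_num, by simp, by simp, by simp⟩, ?_⟩
      rintro r rfl
      rw [zero_div] at hdf
      exact ⟨R40 _, hdf.mono hw (by norm_num), hdf.mono hw (by norm_num), R40 _⟩
    by_cases hb : |f| < |g| ∧ fp.div |f| |g| < u
    · rw [if_pos hb]
      have hm : 1 ≤ 2 * u * |g / f| := by
        have h1 := (fp.div_relClose hu hu' (abs_ne_zero.mpr hg) (R0 |f|) (R0 |g|)).mono
          (k' := 1) hw (by norm_num)
        have h2 := ((RelClose.iff_of_nonneg (by positivity)).1 ⟨h1, by simpa using hw⟩).1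
        have h3 := hb.2
        have h4 : (1 : ℝ) / 2 ≤ Real.exp (-(1 * logUnit u)) := by
          have := Real.add_one_le_exp (-(1 * logUnit u))
          have := logUnit_le hu hu'
          linarith
        have h5 : |f| / |g| * (1 / 2) ≤ |f| / |g| * Real.exp (-(1 * logUnit u)) := by gcongr
        have h6 : |f| / |g| ≤ 2 * u := by linarith
        rw [abs_div]
        have hg0 := abs_pos.mpr hg
        have hf0 := abs_pos.mpr hf
        rw [div_le_iff₀ hg0] at h6
        rw [← mul_div_assoc, le_div_iff₀ hf0]
        linarith
      have hm0 : g / f ≠ 0 := div_ne_zero hg hf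
      obtain ⟨h1, h2, h3, h4⟩ := svd_formulas_of_large hu hu' (p := |h| / |f|) (by positivity)
        (div_le_one_of_le₀ hfh (abs_nonneg f)) hm
      have H := isSVDRotation_formulas hf hg hfh
      generalize svdT (g / f) (|h| / |f|) = T at *
      generalize svdA (g / f) (|h| / |f|) = a at *
      have hsl : RelClose u 40 (fp.div h g) (h / f * (T / √(T * T + 4)) / a) := by
        have h5 := ((RelClose.refl (x := h / f) hw le_rfl).mul h2).div h3
        have h6 : h / f * (g / f / |g / f|) / |g / f| = h / g := by
          have : h / f * (g / f / |g / f|) / |g / f| = h / f * (g / f) / (|g / f| * |g / f|) := by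
            ring
          rw [this, abs_mul_abs_self]
          field_simp
        rw [h6] at h5
        exact (hdh.trans h5.symm).mono hw (by norm_num)
      have hcl := h4.symm.mono (k' := 40) hw (by norm_num)
      -- `xLASV2` returns `1` for the right sine, which is the sign of `m` in the generic formulas
      rcases hm0.lt_or_gt with hneg | hpos
      · refine ⟨_, _, _, _, H.neg_right, ?_⟩
        rintro r rfl
        rw [abs_of_neg hneg] at h1 h2
        refine ⟨hcl, hsl, ?_, ?_⟩
        · have : f / g = -(1 / -(g / f)) := by field_simp
          rw [this] at hdf
          exact (hdf.trans h1.neg.symm).mono hw (by norm_num)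
        · have : -(g / f / -(g / f)) = 1 := by field_simp
          have h7 := h2.neg.symm
          rw [this] at h7
          exact h7.mono hw (by norm_num)
      · refine ⟨_, _, _, _, H, ?_⟩
        rintro r rfl
        rw [abs_of_pos hpos] at h1 h2
        refine ⟨hcl, hsl, ?_, ?_⟩
        · have : f / g = 1 / (g / f) := by field_simp
          rw [this] at hdf
          exact (hdf.trans h1.symm).mono hw (by norm_num)
        · have h7 := h2.symm
          rw [div_self hm0] at h7
          exact h7.mono hw (by norm_num)
    · rw [if_neg hb]
      obtain ⟨cl, sl, cr, sr, H, h1⟩ := fp.lasv2Core_relClose hu hu' hf hg hfh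
      exact ⟨cl, sl, cr, sr, H, by rintro r rfl; exact h1⟩
  unfold FloatModel.lasv2
  by_cases hsw : |f| < |h|
  · simp only [if_pos hsw]
    obtain ⟨cl, sl, cr, sr, H, hr⟩ := key h f hsw.le
    obtain ⟨h1, h2, h3, h4⟩ := hr _ rfl
    exact ⟨sr, cr, sl, cl, H.swap, h4, h3, h2, h1⟩
  · simp only [if_neg hsw]
    obtain ⟨cl, sl, cr, sr, H, hr⟩ := key f h (not_lt.mp hsw)
    exact ⟨cl, sl, cr, sr, H, hr _ rfl⟩

/-! ### Spectral norms of `2 × 2` matrices -/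

theorem Mat2.norm_le_of_sum_sq_le (X : Mat2) {c : ℝ} (hc : 0 ≤ c)
    (h : X 0 0 ^ 2 + X 0 1 ^ 2 + X 1 0 ^ 2 + X 1 1 ^ 2 ≤ c ^ 2) : ‖X‖ ≤ c := by
  rw [Matrix.l2_opNorm_def]
  refine ContinuousLinearMap.opNorm_le_bound _ hc fun x => ?_
  rw [EuclideanSpace.norm_eq, EuclideanSpace.norm_eq]
  refine Real.sqrt_le_iff.mpr ⟨by positivity, ?_⟩
  rw [mul_pow, Real.sq_sqrt (by positivity)]
  simp only [Real.norm_eq_abs, sq_abs, Fin.sum_univ_two]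
  simp [Matrix.toEuclideanLin, Matrix.mulVec, dotProduct, Fin.sum_univ_two]
  have h1 := mul_le_mul_of_nonneg_right h (by positivity : 0 ≤ x 0 ^ 2 + x 1 ^ 2)
  nlinarith [sq_nonneg (X 0 0 * x 1 - X 0 1 * x 0), sq_nonneg (X 1 0 * x 1 - X 1 1 * x 0)]

theorem Mat2.mulVec_sq_le (X : Mat2) (x y : ℝ) :
    (X 0 0 * x + X 0 1 * y) ^ 2 + (X 1 0 * x + X 1 1 * y) ^ 2 ≤ ‖X‖ ^ 2 * (x ^ 2 + y ^ 2) := by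
  have h := Matrix.l2_opNorm_mulVec X (!₂[x, y])
  have h2 := pow_le_pow_left₀ (norm_nonneg _) h 2
  rw [mul_pow, EuclideanSpace.norm_eq, EuclideanSpace.norm_eq, Real.sq_sqrt (by positivity),
    Real.sq_sqrt (by positivity)] at h2
  simpa [Matrix.mulVec, dotProduct, Fin.sum_univ_two] using h2

theorem Mat2.norm_le_of_mulVec_sq_le (X : Mat2) {c : ℝ} (hc : 0 ≤ c)
    (h : ∀ x y : ℝ, (X 0 0 * x + X 0 1 * y) ^ 2 + (X 1 0 * x + X 1 1 * y) ^ 2 ≤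
      c ^ 2 * (x ^ 2 + y ^ 2)) : ‖X‖ ≤ c := by
  rw [Matrix.l2_opNorm_def]
  refine ContinuousLinearMap.opNorm_le_bound _ hc fun x => ?_
  rw [EuclideanSpace.norm_eq, EuclideanSpace.norm_eq]
  refine Real.sqrt_le_iff.mpr ⟨by positivity, ?_⟩
  rw [mul_pow, Real.sq_sqrt (by positivity)]
  simp only [Real.norm_eq_abs, sq_abs, Fin.sum_univ_two]
  simpa [Matrix.toEuclideanLin, Matrix.mulVec, dotProduct, Fin.sum_univ_two] using h (x 0) (x 1)

theorem Mat2.norm_transpose (X : Mat2) : ‖Xᵀ‖ = ‖X‖ := by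
  rw [← Matrix.conjTranspose_eq_transpose_of_trivial, Matrix.l2_opNorm_conjTranspose]

theorem Mat2.norm_adjugate_le (X : Mat2) : ‖X.adjugate‖ ≤ ‖X‖ := by
  rw [← Mat2.norm_transpose X.adjugate]
  refine Mat2.norm_le_of_mulVec_sq_le _ (norm_nonneg X) fun x y => ?_
  have := Mat2.mulVec_sq_le X y (-x)
  rw [Matrix.adjugate_fin_two]
  simp
  nlinarith

/-- A triangular `2 × 2` matrix becomes entrywise nonnegative when multiplied by suitable diagonal
matrices of signs, so its entrywise absolute value has the same norm. -/
theorem Mat2.norm_absM_le (X : Mat2) (h : X 1 0 = 0) : ‖absM X‖ ≤ ‖X‖ := by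
  refine Mat2.norm_le_of_mulVec_sq_le _ (norm_nonneg X) fun x y => ?_
  have h1 := Mat2.mulVec_sq_le X x y
  have h2 := Mat2.mulVec_sq_le X x (-y)
  simp only [absM, Matrix.map_apply, h, abs_zero, zero_mul, zero_add] at *
  have h3 : (|X 0 0| * x + |X 0 1| * y) ^ 2 = (X 0 0 * x + X 0 1 * y) ^ 2 ∨
      (|X 0 0| * x + |X 0 1| * y) ^ 2 = (X 0 0 * x + X 0 1 * -y) ^ 2 := by
    rcases abs_choice (X 0 0) with ha | ha <;> rcases abs_choice (X 0 1) with hb | hb <;>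
      rw [ha, hb]
    · left; ring
    · right; ring
    · right; ring
    · left; ring
  rw [mul_pow, sq_abs]
  rcases h3 with h3 | h3 <;> rw [h3] <;> nlinarith

theorem Mat2.col_mul_sq_le (X Y : Mat2) (j : Fin 2) :
    (X * Y) 0 j ^ 2 + (X * Y) 1 j ^ 2 ≤ ‖X‖ ^ 2 * (Y 0 j ^ 2 + Y 1 j ^ 2) := by
  simpa [Matrix.mul_apply, Fin.sum_univ_two] using Mat2.mulVec_sq_le X (Y 0 j) (Y 1 j)

theorem Mat2.row_mul_sq_le (X Y : Mat2) (i : Fin 2) :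
    (X * Y) i 0 ^ 2 + (X * Y) i 1 ^ 2 ≤ ‖Y‖ ^ 2 * (X i 0 ^ 2 + X i 1 ^ 2) := by
  have := Mat2.col_mul_sq_le Yᵀ Xᵀ i
  rw [Mat2.norm_transpose, ← Matrix.transpose_mul] at this
  simpa using this

theorem Mat2.norm_le_one_of_orthogonal {X : Mat2} (h : Xᵀ * X = 1) : ‖X‖ ≤ 1 := by
  have h1 := Matrix.l2_opNorm_conjTranspose_mul_self X
  rw [Matrix.conjTranspose_eq_transpose_of_trivial, h, norm_one] at h1
  nlinarith [norm_nonneg X]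

theorem Mat2.col_sq_of_orthogonal {X : Mat2} (h : Xᵀ * X = 1) (j : Fin 2) :
    X 0 j ^ 2 + X 1 j ^ 2 = 1 := by
  have := congrFun (congrFun h j) j
  simp [Matrix.mul_apply, Fin.sum_univ_two] at this
  linarith

/-- Multiplication by orthogonal matrices does not increase the norm. -/
theorem Mat2.norm_mul_mul_le {X V Q : Mat2} (hV : ‖V‖ ≤ 1) (hQ : ‖Q‖ ≤ 1) :
    ‖V * X * Q‖ ≤ ‖X‖ := by
  have h1 := Matrix.l2_opNorm_mul (V * X) Q
  have h2 := Matrix.l2_opNorm_mul V X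
  have h3 : ‖V‖ * ‖X‖ ≤ 1 * ‖X‖ := by gcongr
  have h4 : ‖V * X‖ * ‖Q‖ ≤ ‖V * X‖ * 1 := by gcongr
  linarith

theorem parallelRows_of_isDiag_mul {X Y : Mat2} (h : (X * Y).IsDiag) :
    ParallelRows X Y.adjugate := by
  have det : ∀ a b c d : ℝ, a * d = b * c → ¬ LinearIndependent ℝ ![![a, b], ![c, d]] := by
    intro a b c d h hli
    rw [LinearIndependent.pair_iff] at hli
    have h1 := hli c (-a) (by ext i; fin_cases i <;> simp <;> linarith)
    have h2 := hli d (-b) (by ext i; fin_cases i <;> simp <;> linarith)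
    have h3 := hli 1 0 (by
      ext i; fin_cases i <;> simp <;> linarith [h1.2, h2.2])
    exact one_ne_zero h3.1
  have e : ∀ v : Fin 2 → ℝ, v = ![v 0, v 1] := fun v => by ext i; fin_cases i <;> rfl
  have h01 := h (show (0 : Fin 2) ≠ 1 by decide)
  have h10 := h (show (1 : Fin 2) ≠ 0 by decide)
  simp only [Matrix.mul_apply, Fin.sum_univ_two] at h01 h10
  intro i
  rw [e (X i), e (Y.adjugate i), Matrix.adjugate_fin_two]
  apply det
  fin_cases i <;> simp <;> linarith

theorem parallelCols_of_isDiag_mul {X Y : Mat2} (h : (X * Y).IsDiag) :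
    ParallelCols X.adjugate Y := by
  have h1 : (X.adjugateᵀ * Yᵀ.adjugate).IsDiag := by
    intro i j hij
    have h01 := h (show (0 : Fin 2) ≠ 1 by decide)
    have h10 := h (show (1 : Fin 2) ≠ 0 by decide)
    simp only [Matrix.mul_apply, Fin.sum_univ_two] at h01 h10
    fin_cases i <;> fin_cases j <;>
      simp [Matrix.adjugate_fin_two, Matrix.mul_apply, Fin.sum_univ_two] at hij ⊢ <;> linarith
  have := parallelRows_of_isDiag_mul h1
  simpa [Matrix.adjugate_adjugate', ParallelCols] using this

/-! ### Middle rotations -/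

theorem rotCS_orthogonal {c s : ℝ} (h : c ^ 2 + s ^ 2 = 1) :
    (rotCS (c, s))ᵀ * rotCS (c, s) = 1 ∧ rotCS (c, s) * (rotCS (c, s))ᵀ = 1 := by
  constructor <;> ext i j <;> fin_cases i <;> fin_cases j <;>
    simp [rotCS, Matrix.mul_apply, Fin.sum_univ_two] <;> linarith

theorem relClose_rotCS {u k : ℝ} {p : ℝ × ℝ} {c s : ℝ} (h1 : RelClose u k p.1 c)
    (h2 : RelClose u k p.2 s) (i j : Fin 2) : RelClose u k (rotCS p i j) (rotCS (c, s) i j) := by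
  fin_cases i <;> fin_cases j <;> simp [rotCS, h1, h2, h2.neg]

theorem abs_mul_add_mul_le {a b c d α β B : ℝ} (ha : |a| ≤ α) (hb : |b| ≤ B) (hc : |c| ≤ β)
    (hd : |d| ≤ B) : |a * b + c * d| ≤ (α + β) * B := by
  refine (abs_add_le _ _).trans ?_
  rw [abs_mul, abs_mul, add_mul]
  exact add_le_add (mul_le_mul ha hb (abs_nonneg _) ((abs_nonneg _).trans ha))
    (mul_le_mul hc hd (abs_nonneg _) ((abs_nonneg _).trans hc))

/-- Let `(p, q)` and `(x, y)` approximate orthogonal vectors with componentwise errors relative to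
`(γ₁, γ₂)` and `(χ₁, χ₂)`. If `(p, q)` suffers from cancellation no more than `(x, y)`, then
`(x, y)` is nearly orthogonal to the unit vector `(c, s)` parallel to `(p, q)`. -/
theorem abs_inner_le_of_growth_le {u p q x y p' q' x' y' γ₁ γ₂ χ₁ χ₂ c s : ℝ} (hu : 0 < u)
    (hp : |p - p'| ≤ 50 * u * γ₁) (hq : |q - q'| ≤ 50 * u * γ₂)
    (hx : |x - x'| ≤ 50 * u * χ₁) (hy : |y - y'| ≤ 50 * u * χ₂)
    (h0 : p' * x' + q' * y' = 0) (hS : 0 < |p| + |q|)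
    (hη : (γ₁ + γ₂) * (|x| + |y|) ≤ 101 / 100 * ((χ₁ + χ₂) * (|p| + |q|)))
    (hcs : c ^ 2 + s ^ 2 = 1) (hdir : p * s = q * c) :
    |c * x + s * y| ≤ 160 * u * (χ₁ + χ₂) := by
  have hγ₁ : 0 ≤ γ₁ := by
    have := (abs_nonneg _).trans hp
    exact nonneg_of_mul_nonneg_right this (by positivity)
  have hγ₂ : 0 ≤ γ₂ := by
    have := (abs_nonneg _).trans hq
    exact nonneg_of_mul_nonneg_right this (by positivity)
  have hχ₁ : 0 ≤ χ₁ := by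
    have := (abs_nonneg _).trans hx
    exact nonneg_of_mul_nonneg_right this (by positivity)
  have hχ₂ : 0 ≤ χ₂ := by
    have := (abs_nonneg _).trans hy
    exact nonneg_of_mul_nonneg_right this (by positivity)
  have hc1 : |c| ≤ 1 := abs_le_one_iff_mul_self_le_one.mpr (by nlinarith)
  have hs1 : |s| ≤ 1 := abs_le_one_iff_mul_self_le_one.mpr (by nlinarith)
  obtain ⟨r, hr⟩ : ∃ r, r = c * p + s * q := ⟨_, rfl⟩
  have hpr : p = r * c := by rw [hr]; linear_combination (-p) * hcs + s * hdir
  have hqr : q = r * s := by rw [hr]; linear_combination (-q) * hcs - c * hdir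
  have hpa : |p| = |r| * |c| := by rw [← abs_mul, ← hpr]
  have hqa : |q| = |r| * |s| := by rw [← abs_mul, ← hqr]
  have hcs' : |c| + |s| ≤ 1415 / 1000 := by
    refine le_of_sq_le_sq ?_ (by norm_num)
    nlinarith [sq_abs c, sq_abs s, sq_nonneg (|c| - |s|)]
  have hSr : |p| + |q| ≤ 1415 / 1000 * |r| := by
    rw [hpa, hqa]; nlinarith [abs_nonneg r]
  have hr0 : 0 < |r| := by linarith
  obtain ⟨S, hSd⟩ : ∃ S, S = |p| + |q| := ⟨_, rfl⟩
  obtain ⟨T, hT⟩ : ∃ T, T = |x| + |y| := ⟨_, rfl⟩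
  rw [← hSd] at hS hη hSr
  rw [← hT] at hη
  have hT0 : 0 ≤ T := by rw [hT]; positivity
  have hval : |c * x + s * y| ≤ T := by
    refine (abs_add_le _ _).trans ?_
    rw [abs_mul, abs_mul]
    have := mul_le_mul_of_nonneg_right hc1 (abs_nonneg x)
    have := mul_le_mul_of_nonneg_right hs1 (abs_nonneg y)
    linarith
  rcases le_or_gt (100 * u * (γ₁ + γ₂)) S with hcase | hcase
  · -- the errors of `(p, q)` are at most half its size, which bounds the second-order term
    refine le_of_mul_le_mul_left ?_ hr0
    rw [← abs_mul]
    have e1 : r * (c * x + s * y) = ((p - p') * x + (q - q') * y) +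
        ((x - x') * p + (y - y') * q) - ((p - p') * (x - x') + (q - q') * (y - y')) := by
      linear_combination (-x) * hpr - y * hqr + h0
    have b1 := abs_mul_add_mul_le (b := x) (d := y) (B := T) hp (by linarith [abs_nonneg y])
      hq (by linarith [abs_nonneg x])
    have b2 := abs_mul_add_mul_le (B := |r|) hx
      (by rw [hpa]; exact mul_le_of_le_one_right (abs_nonneg r) hc1) hy
      (by rw [hqa]; exact mul_le_of_le_one_right (abs_nonneg r) hs1)
    have b3 := abs_mul_add_mul_le (B := 50 * u * (χ₁ + χ₂)) hp
      (hx.trans (by gcongr; linarith)) hq (hy.trans (by gcongr; linarith))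
    have b4 : (50 * u * γ₁ + 50 * u * γ₂) * (50 * u * (χ₁ + χ₂)) ≤
        (1 / 2 * S) * (50 * u * (χ₁ + χ₂)) := by
      gcongr
      linarith
    have b5 : (χ₁ + χ₂) * S ≤ (χ₁ + χ₂) * (1415 / 1000 * |r|) := by gcongr
    have b6 : u * ((γ₁ + γ₂) * T) ≤ u * (101 / 100 * ((χ₁ + χ₂) * (1415 / 1000 * |r|))) :=
      mul_le_mul_of_nonneg_left (by linarith) hu.le
    have b7 : u * ((χ₁ + χ₂) * S) ≤ u * ((χ₁ + χ₂) * (1415 / 1000 * |r|)) := by gcongr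
    have b8 : 0 ≤ u * ((χ₁ + χ₂) * |r|) := by positivity
    rw [e1]
    have := abs_add_le (((p - p') * x + (q - q') * y) + ((x - x') * p + (y - y') * q))
      (-((p - p') * (x - x') + (q - q') * (y - y')))
    rw [abs_neg, ← sub_eq_add_neg] at this
    have := abs_add_le ((p - p') * x + (q - q') * y) ((x - x') * p + (y - y') * q)
    linarith
  · -- `(p, q)` carries no information, and by the comparison of the growths `(x, y)` is tiny
    refine hval.trans (le_of_mul_le_mul_right ?_ hS)
    have h1 : T * S ≤ T * (100 * u * (γ₁ + γ₂)) := by gcongr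
    have h2 : u * ((γ₁ + γ₂) * T) ≤ u * (101 / 100 * ((χ₁ + χ₂) * S)) := by gcongr
    have h3 : 0 ≤ u * ((χ₁ + χ₂) * S) := by positivity
    linarith

theorem abs_dot_le {a b c d m : ℝ} (hm : 0 ≤ m) (h1 : a ^ 2 + b ^ 2 ≤ m ^ 2)
    (h2 : c ^ 2 + d ^ 2 = 1) : |a * c + b * d| ≤ m := by
  refine abs_le_of_sq_le_sq ?_ hm
  nlinarith [sq_nonneg (a * d - b * c)]

/-- Entries that approximate `X₀` up to 50 roundings relative to `Xh`, while `X₀` is bounded by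
`Xh`, have Euclidean norm at most that of `Xh`, up to a factor close to one. -/
theorem sq_add_sq_le_of_close {u a b a' b' α β m : ℝ} (hu' : u ≤ 1 / 10 ^ 6)
    (h1 : |a - a'| ≤ 50 * u * α) (h2 : |b - b'| ≤ 50 * u * β) (h3 : |a'| ≤ α) (h4 : |b'| ≤ β)
    (h : α ^ 2 + β ^ 2 ≤ m ^ 2) : a ^ 2 + b ^ 2 ≤ (1001 / 1000 * m) ^ 2 := by
  have key : ∀ {a a' α : ℝ}, |a - a'| ≤ 50 * u * α → |a'| ≤ α →
      a ^ 2 ≤ (1001 / 1000) ^ 2 * α ^ 2 := by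
    intro a a' α h1 h3
    have hα := (abs_nonneg _).trans h3
    have := abs_add_le (a - a') a'
    rw [sub_add_cancel] at this
    have h5 : |a| ≤ 1001 / 1000 * α := by nlinarith
    rw [← sq_abs, ← mul_pow]
    exact pow_le_pow_left₀ (abs_nonneg a) h5 2
  have := key h1 h3
  have := key h2 h4
  rw [mul_pow]
  linarith

/-- The data for the choice of a middle rotation: the computed factors `G` and `H` are close to
factors `Gt` and `Ht` whose product is diagonal, and close to the exact factors `G₀` and `H₀`.
Errors are relative to `Gh` and `Hh`. -/
structure FactorPair (u μ ν : ℝ) (G Gt G₀ Gh H Ht H₀ Hh : Mat2) : Prop where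
  μ_nonneg : 0 ≤ μ
  ν_nonneg : 0 ≤ ν
  G_tilde : ∀ i j, |G i j - Gt i j| ≤ 50 * u * Gh i j
  G_exact : ∀ i j, |G i j - G₀ i j| ≤ 50 * u * Gh i j
  G_bound : ∀ i j, |G₀ i j| ≤ Gh i j
  G_row : ∀ i, Gh i 0 ^ 2 + Gh i 1 ^ 2 ≤ μ ^ 2
  H_tilde : ∀ i j, |H i j - Ht i j| ≤ 50 * u * Hh i j
  H_exact : ∀ i j, |H i j - H₀ i j| ≤ 50 * u * Hh i j
  H_bound : ∀ i j, |H₀ i j| ≤ Hh i j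
  H_col : ∀ j, Hh 0 j ^ 2 + Hh 1 j ^ 2 ≤ ν ^ 2
  diag : (Gt * Ht).IsDiag

/-- The conclusions about the products of the factors with a computed middle rotation `Qb`. -/
structure FactorPairResult (u μ ν : ℝ) (fp : FloatModel u) (G G₀ H H₀ Qb Q : Mat2) : Prop where
  orth : Qᵀ * Q = 1
  left : ‖zero12 (fp.mulM G Qb) - G₀ * Q‖ ≤ 480 * u * μ
  right : ‖zero12 (fp.mulM Qbᵀ H) - Qᵀ * H₀‖ ≤ 480 * u * ν
  near_diag : ∃ X Y : Mat2, ‖X‖ ≤ 80 * u * μ ∧ ‖Y‖ ≤ 80 * u * ν ∧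
    ((zero12 (fp.mulM G Qb) + X) * (zero12 (fp.mulM Qbᵀ H) + Y)).IsDiag

/-- Setting the (1,2) entry to zero costs at most 230 roundings, computing the other entries at most 6
each, and the difference between the computed and the exact factor at most `71 > 50 √2`. -/
theorem norm_zero12_sub_le {u m : ℝ} (hu : 0 < u) (hm : 0 ≤ m) {Z W W₀ : Mat2}
    (h01 : |W 0 1| ≤ 230 * u * m) (h : ∀ i j, |Z i j - W i j| ≤ 6 * u * m)
    (hW : ‖W - W₀‖ ≤ 71 * u * m) : ‖zero12 Z - W₀‖ ≤ 480 * u * m := by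
  have hum : 0 ≤ u * m := by positivity
  have h1 : ‖zero12 Z - W‖ ≤ 240 * u * m := by
    refine Mat2.norm_le_of_sum_sq_le _ (by positivity) ?_
    have a := sq_le_sq' (abs_le.mp (h 0 0)).1 (abs_le.mp (h 0 0)).2
    have b := sq_le_sq' (abs_le.mp h01).1 (abs_le.mp h01).2
    have c := sq_le_sq' (abs_le.mp (h 1 0)).1 (abs_le.mp (h 1 0)).2
    have d := sq_le_sq' (abs_le.mp (h 1 1)).1 (abs_le.mp (h 1 1)).2
    simp [zero12]
    nlinarith
  have h2 := norm_add_le (zero12 Z - W) (W - W₀)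
  rw [sub_add_sub_cancel] at h2
  linarith

theorem norm_le_of_entries_le {u m : ℝ} (hu : 0 < u) {X Xh : Mat2} (hm : 0 ≤ m)
    (h : ∀ i j, |X i j| ≤ 50 * u * Xh i j)
    (hn : Xh 0 0 ^ 2 + Xh 0 1 ^ 2 + Xh 1 0 ^ 2 + Xh 1 1 ^ 2 ≤ 2 * m ^ 2) :
    ‖X‖ ≤ 71 * u * m := by
  refine Mat2.norm_le_of_sum_sq_le _ (by positivity) ?_
  have a := sq_le_sq' (abs_le.mp (h 0 0)).1 (abs_le.mp (h 0 0)).2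
  have b := sq_le_sq' (abs_le.mp (h 0 1)).1 (abs_le.mp (h 0 1)).2
  have c := sq_le_sq' (abs_le.mp (h 1 0)).1 (abs_le.mp (h 1 0)).2
  have d := sq_le_sq' (abs_le.mp (h 1 1)).1 (abs_le.mp (h 1 1)).2
  have e := mul_le_mul_of_nonneg_left hn (sq_nonneg u)
  have f : 0 ≤ u ^ 2 * m ^ 2 := by positivity
  nlinarith

/-- The errors of a computed middle rotation `Qb` for which the exact rotation `Q` makes both
products nearly lower triangular. -/
theorem FactorPair.result {u μ ν : ℝ} (hu : 0 < u) (hu' : u ≤ 1 / 10 ^ 6) (fp : FloatModel u)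
    {G Gt G₀ Gh H Ht H₀ Hh Qb Q : Mat2} (F : FactorPair u μ ν G Gt G₀ Gh H Ht H₀ Hh)
    (hQ₁ : Qᵀ * Q = 1) (hQ₂ : Q * Qᵀ = 1) (hQb : ∀ i j, RelClose u 3 (Qb i j) (Q i j))
    (hGQ : |(G * Q) 0 1| ≤ 230 * u * μ) (hQH : |(Qᵀ * H) 0 1| ≤ 230 * u * ν) :
    FactorPairResult u μ ν fp G G₀ H H₀ Qb Q := by
  have hw := logUnit_nonneg hu hu'
  have hμ := F.μ_nonneg
  have hν := F.ν_nonneg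
  have hexp := exp_logUnit_sub_one_le (k := 5) hu hu' (by norm_num) (by norm_num)
  have hQ1 := Mat2.norm_le_one_of_orthogonal hQ₁
  have hQt1 : ‖Qᵀ‖ ≤ 1 := by rwa [Mat2.norm_transpose]
  have hcol := Mat2.col_sq_of_orthogonal hQ₁
  -- rounding errors of the two products
  have eG : ∀ i j, |fp.mulM G Qb i j - (G * Q) i j| ≤ 6 * u * μ := by
    intro i j
    have h1 := (fp.mulM_nearBy hu hu' le_rfl (by norm_num : (0 : ℝ) ≤ 3)
      (X := G) (X' := G) (Xh := absM G) (Yh := absM Q) (fun i j => .refl hw le_rfl)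
      (fun i j => .of_relClose hw (by norm_num) (hQb i j)) i j).1
    have h2 := abs_dot_le (m := 1001 / 1000 * μ) (by positivity) (a := |G i 0|) (b := |G i 1|) (c := |Q 0 j|)
      (d := |Q 1 j|) (by
        rw [sq_abs, sq_abs]
        exact sq_add_sq_le_of_close hu' (F.G_exact i 0) (F.G_exact i 1) (F.G_bound i 0)
          (F.G_bound i 1) (F.G_row i)) (by rw [sq_abs, sq_abs]; exact hcol j)
    simp only [absM, Matrix.mul_apply (M := Matrix.map _ _), Fin.sum_univ_two,
      Matrix.map_apply] at h1
    have h3 := le_of_abs_le h2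
    norm_num at h1
    refine h1.trans ((mul_le_mul hexp h3 (by positivity) (by positivity)).trans ?_)
    nlinarith [mul_nonneg hu.le hμ]
  have eH : ∀ i j, |fp.mulM Qbᵀ H i j - (Qᵀ * H) i j| ≤ 6 * u * ν := by
    intro i j
    have h1 := (fp.mulM_nearBy hu hu' (by norm_num : (0 : ℝ) ≤ 3) le_rfl
      (X := Qbᵀ) (X' := Qᵀ) (Xh := absM Qᵀ) (Yh := absM H)
      (fun i j => .of_relClose hw (by norm_num) (hQb j i)) (fun i j => .refl hw le_rfl) i j).1
    have h2 := abs_dot_le (m := 1001 / 1000 * ν) (by positivity) (a := |H 0 j|) (b := |H 1 j|) (c := |Q 0 i|)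
      (d := |Q 1 i|) (by
        rw [sq_abs, sq_abs]
        exact sq_add_sq_le_of_close hu' (F.H_exact 0 j) (F.H_exact 1 j) (F.H_bound 0 j)
          (F.H_bound 1 j) (F.H_col j)) (by rw [sq_abs, sq_abs]; exact hcol i)
    simp only [absM, Matrix.mul_apply (M := Matrix.map _ _), Fin.sum_univ_two,
      Matrix.map_apply, Matrix.transpose_apply] at h1
    have h3 := le_of_abs_le h2
    norm_num at h1
    rw [mul_comm |H 0 j|, mul_comm |H 1 j|] at h3
    refine h1.trans ((mul_le_mul hexp h3 (by positivity) (by positivity)).trans ?_)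
    nlinarith [mul_nonneg hu.le hν]
  have n1 : ∀ X : Mat2, ‖X * Q‖ ≤ ‖X‖ := fun X => by
    simpa using Mat2.norm_mul_mul_le (X := X) (V := 1) (Q := Q) (by simp) hQ1
  have n2 : ∀ X : Mat2, ‖Qᵀ * X‖ ≤ ‖X‖ := fun X => by
    simpa using Mat2.norm_mul_mul_le (X := X) (V := Qᵀ) (Q := 1) hQt1 (by simp)
  refine ⟨hQ₁, norm_zero12_sub_le hu hμ hGQ eG ?_, norm_zero12_sub_le hu hν hQH eH ?_, ?_⟩
  · rw [← sub_mul]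
    exact (n1 _).trans (norm_le_of_entries_le hu hμ F.G_exact (by linarith [F.G_row 0, F.G_row 1]))
  · rw [← mul_sub]
    exact (n2 _).trans (norm_le_of_entries_le hu hν F.H_exact (by linarith [F.H_col 0, F.H_col 1]))
  -- only the second row of the first factor and the first column of the second are perturbed
  set Z := fp.mulM G Qb
  set W := fp.mulM Qbᵀ H
  refine ⟨!![0, 0; (Gt * Q) 1 0 - Z 1 0, (Gt * Q) 1 1 - Z 1 1],
    !![(Qᵀ * Ht) 0 0 - W 0 0, 0; (Qᵀ * Ht) 1 0 - W 1 0, 0], ?_, ?_, ?_⟩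
  · have h1 : ‖(!![0, 0; (Gt * Q) 1 0 - Z 1 0, (Gt * Q) 1 1 - Z 1 1] : Mat2) -
        !![0, 0; Gt 1 0 - G 1 0, Gt 1 1 - G 1 1] * Q‖ ≤ 10 * u * μ := by
      refine Mat2.norm_le_of_sum_sq_le _ (by positivity) ?_
      have a := sq_le_sq' (abs_le.mp (eG 1 0)).1 (abs_le.mp (eG 1 0)).2
      have b := sq_le_sq' (abs_le.mp (eG 1 1)).1 (abs_le.mp (eG 1 1)).2
      simp only [Matrix.mul_apply, Fin.sum_univ_two] at a b
      simp [Matrix.vecMul, dotProduct, Matrix.mul_apply, Fin.sum_univ_two]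
      have hum : 0 ≤ u * μ := by positivity
      nlinarith
    have h2 : ‖(!![0, 0; Gt 1 0 - G 1 0, Gt 1 1 - G 1 1] : Mat2)‖ ≤ 50 * u * μ := by
      refine Mat2.norm_le_of_sum_sq_le _ (by positivity) ?_
      have a := sq_le_sq' (abs_le.mp (F.G_tilde 1 0)).1 (abs_le.mp (F.G_tilde 1 0)).2
      have b := sq_le_sq' (abs_le.mp (F.G_tilde 1 1)).1 (abs_le.mp (F.G_tilde 1 1)).2
      have e := mul_le_mul_of_nonneg_left (F.G_row 1) (sq_nonneg u)
      simp
      nlinarith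
    have h3 := norm_add_le ((!![0, 0; (Gt * Q) 1 0 - Z 1 0, (Gt * Q) 1 1 - Z 1 1] : Mat2) -
        !![0, 0; Gt 1 0 - G 1 0, Gt 1 1 - G 1 1] * Q)
        (!![0, 0; Gt 1 0 - G 1 0, Gt 1 1 - G 1 1] * Q)
    rw [sub_add_cancel] at h3
    have h4 := n1 !![0, 0; Gt 1 0 - G 1 0, Gt 1 1 - G 1 1]
    have : 0 ≤ u * μ := by positivity
    linarith
  · have h1 : ‖(!![(Qᵀ * Ht) 0 0 - W 0 0, 0; (Qᵀ * Ht) 1 0 - W 1 0, 0] : Mat2) -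
        Qᵀ * !![Ht 0 0 - H 0 0, 0; Ht 1 0 - H 1 0, 0]‖ ≤ 10 * u * ν := by
      refine Mat2.norm_le_of_sum_sq_le _ (by positivity) ?_
      have a := sq_le_sq' (abs_le.mp (eH 0 0)).1 (abs_le.mp (eH 0 0)).2
      have b := sq_le_sq' (abs_le.mp (eH 1 0)).1 (abs_le.mp (eH 1 0)).2
      simp only [Matrix.mul_apply, Fin.sum_univ_two, Matrix.transpose_apply] at a b
      simp [Matrix.mul_apply, Fin.sum_univ_two]
      have hum : 0 ≤ u * ν := by positivity
      nlinarith
    have h2 : ‖(!![Ht 0 0 - H 0 0, 0; Ht 1 0 - H 1 0, 0] : Mat2)‖ ≤ 50 * u * ν := by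
      refine Mat2.norm_le_of_sum_sq_le _ (by positivity) ?_
      have a := sq_le_sq' (abs_le.mp (F.H_tilde 0 0)).1 (abs_le.mp (F.H_tilde 0 0)).2
      have b := sq_le_sq' (abs_le.mp (F.H_tilde 1 0)).1 (abs_le.mp (F.H_tilde 1 0)).2
      have e := mul_le_mul_of_nonneg_left (F.H_col 0) (sq_nonneg u)
      simp
      nlinarith
    have h3 := norm_add_le ((!![(Qᵀ * Ht) 0 0 - W 0 0, 0; (Qᵀ * Ht) 1 0 - W 1 0, 0] : Mat2) -
        Qᵀ * !![Ht 0 0 - H 0 0, 0; Ht 1 0 - H 1 0, 0])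
        (Qᵀ * !![Ht 0 0 - H 0 0, 0; Ht 1 0 - H 1 0, 0])
    rw [sub_add_cancel] at h3
    have h4 := n2 !![Ht 0 0 - H 0 0, 0; Ht 1 0 - H 1 0, 0]
    have : 0 ≤ u * ν := by positivity
    linarith
  · have h1 : Gt * Q * (Qᵀ * Ht) = Gt * Ht := by
      rw [Matrix.mul_assoc, ← Matrix.mul_assoc Q, hQ₂, Matrix.one_mul]
    have h2 := F.diag (show (1 : Fin 2) ≠ 0 by decide)
    rw [← h1, Matrix.mul_apply, Fin.sum_univ_two] at h2
    intro i j hij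
    fin_cases i <;> fin_cases j <;>
      simp [zero12] at hij ⊢
    exact h2

/-- The rotation computed from the first row of the left factor, which suffers from cancellation
no more than the second column of the right factor (unless that column vanishes). -/
theorem FactorPair.exists_result_of_row {u μ ν : ℝ} (hu : 0 < u) (hu' : u ≤ 1 / 10 ^ 6)
    (fp : FloatModel u) {G Gt G₀ Gh H Ht H₀ Hh : Mat2}
    (F : FactorPair u μ ν G Gt G₀ Gh H Ht H₀ Hh)
    (h : (H 0 1 = 0 ∧ H 1 1 = 0) ∨ 0 < |G 0 0| + |G 0 1| ∧
      (Gh 0 0 + Gh 0 1) * (|H 0 1| + |H 1 1|) ≤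
        101 / 100 * ((Hh 0 1 + Hh 1 1) * (|G 0 0| + |G 0 1|))) :
    ∃ Q, FactorPairResult u μ ν fp G G₀ H H₀ (rotCS (fp.lartg (G 0 0) (G 0 1)))ᵀ Q := by
  obtain ⟨c, s, hcs, hdir, hc, hs⟩ := fp.lartg_relClose hu hu' (G 0 0) (G 0 1)
  have ho := rotCS_orthogonal hcs
  have hμ := F.μ_nonneg
  have hν := F.ν_nonneg
  refine ⟨(rotCS (c, s))ᵀ, F.result hu hu' fp (by simpa using ho.2) (by simpa using ho.1)
    (fun i j => relClose_rotCS hc hs j i) ?_ ?_⟩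
  · have : (G * (rotCS (c, s))ᵀ) 0 1 = 0 := by
      simp [rotCS, Matrix.mul_apply, Fin.sum_univ_two]; linarith
    rw [this, abs_zero]
    positivity
  · have e : ((rotCS (c, s))ᵀᵀ * H) 0 1 = c * H 0 1 + s * H 1 1 := by
      simp [rotCS, Matrix.mul_apply, Fin.sum_univ_two]
    rw [e]
    rcases h with ⟨h1, h2⟩ | ⟨h1, h2⟩
    · rw [h1, h2]; simp; positivity
    · have h0 : (Gt * Ht) 0 1 = 0 := F.diag (show (0 : Fin 2) ≠ 1 by decide)
      rw [Matrix.mul_apply, Fin.sum_univ_two] at h0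
      refine (abs_inner_le_of_growth_le hu (F.G_tilde 0 0) (F.G_tilde 0 1) (F.H_tilde 0 1)
        (F.H_tilde 1 1) h0 h1 h2 hcs hdir).trans ?_
      have h3 : Hh 0 1 + Hh 1 1 ≤ 1415 / 1000 * ν := by
        refine le_of_sq_le_sq ?_ (by positivity)
        nlinarith [F.H_col 1, sq_nonneg (Hh 0 1 - Hh 1 1)]
      nlinarith [mul_le_mul_of_nonneg_left h3 hu.le, mul_nonneg hu.le hν]

/-- The rotation computed from the second column of the right factor, which suffers from
cancellation no more than the first row of the left factor (unless that row vanishes). -/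
theorem FactorPair.exists_result_of_col {u μ ν : ℝ} (hu : 0 < u) (hu' : u ≤ 1 / 10 ^ 6)
    (fp : FloatModel u) {G Gt G₀ Gh H Ht H₀ Hh : Mat2}
    (F : FactorPair u μ ν G Gt G₀ Gh H Ht H₀ Hh)
    (h : (G 0 0 = 0 ∧ G 0 1 = 0) ∨ 0 < |H 0 1| + |H 1 1| ∧
      (Hh 0 1 + Hh 1 1) * (|G 0 0| + |G 0 1|) ≤
        101 / 100 * ((Gh 0 0 + Gh 0 1) * (|H 0 1| + |H 1 1|))) :
    ∃ Q, FactorPairResult u μ ν fp G G₀ H H₀ (rotCS (fp.lartg (H 1 1) (H 0 1))) Q := by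
  obtain ⟨c, s, hcs, hdir, hc, hs⟩ := fp.lartg_relClose hu hu' (H 1 1) (H 0 1)
  have ho := rotCS_orthogonal hcs
  have hμ := F.μ_nonneg
  have hν := F.ν_nonneg
  refine ⟨rotCS (c, s), F.result hu hu' fp ho.1 ho.2 (fun i j => relClose_rotCS hc hs i j) ?_ ?_⟩
  · have e : (G * rotCS (c, s)) 0 1 = s * G 0 0 + c * G 0 1 := by
      simp [rotCS, Matrix.mul_apply, Fin.sum_univ_two]; ring
    rw [e]
    rcases h with ⟨h1, h2⟩ | ⟨h1, h2⟩
    · rw [h1, h2]; simp; positivity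
    · have h0 : (Gt * Ht) 0 1 = 0 := F.diag (show (0 : Fin 2) ≠ 1 by decide)
      rw [Matrix.mul_apply, Fin.sum_univ_two] at h0
      refine (abs_inner_le_of_growth_le hu (F.H_tilde 0 1) (F.H_tilde 1 1) (F.G_tilde 0 0)
        (F.G_tilde 0 1) (by linarith) h1 h2 (by linarith) hdir.symm).trans ?_
      have h3 : Gh 0 0 + Gh 0 1 ≤ 1415 / 1000 * μ := by
        refine le_of_sq_le_sq ?_ (by positivity)
        nlinarith [F.G_row 0, sq_nonneg (Gh 0 0 - Gh 0 1)]
      nlinarith [mul_le_mul_of_nonneg_left h3 hu.le, mul_nonneg hu.le hμ]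
  · have : ((rotCS (c, s))ᵀ * H) 0 1 = 0 := by
      simp [rotCS, Matrix.mul_apply, Fin.sum_univ_two]; linarith
    rw [this, abs_zero]
    positivity

theorem FloatModel.mulM_relClose_of_nonneg {u k k' : ℝ} (hu : 0 < u) (hu' : u ≤ 1 / 10 ^ 6)
    (fp : FloatModel u) (hk : 0 ≤ k) (hk' : 0 ≤ k') {X X' Y Y' : Mat2}
    (hX : ∀ i j, RelClose u k (X i j) (X' i j)) (hY : ∀ i j, RelClose u k' (Y i j) (Y' i j))
    (hX0 : ∀ i j, 0 ≤ X' i j) (hY0 : ∀ i j, 0 ≤ Y' i j) (i j : Fin 2) :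
    RelClose u (k + k' + 2) (fp.mulM X Y i j) ((X' * Y') i j) := by
  have := fp.add_relClose hu hu' (by positivity) (fp.mul_relClose hu hu' (hX i 0) (hY 0 j))
    (fp.mul_relClose hu hu' (hX i 1) (hY 1 j))
    (mul_nonneg (mul_nonneg (hX0 _ _) (hY0 _ _)) (mul_nonneg (hX0 _ _) (hY0 _ _)))
  simp only [Matrix.mul_apply, Fin.sum_univ_two, mulM, Matrix.of_apply]
  convert this using 1
  rw [max_self]; ring

/-- A comparison of computed growth factors is a comparison of the exact ones, up to a factor close
to one. -/
theorem FloatModel.growth_le_of_div_le {u : ℝ} (hu : 0 < u) (hu' : u ≤ 1 / 10 ^ 6)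
    (fp : FloatModel u) {ng nh dg dh γ χ S T : ℝ} (hng : RelClose u 45 ng γ)
    (hnh : RelClose u 45 nh χ) (hdg : RelClose u 1 dg S) (hdh : RelClose u 1 dh T)
    (hγ : 0 ≤ γ) (hχ : 0 ≤ χ) (hS : 0 < S) (hT : 0 < T) (h : fp.div ng dg ≤ fp.div nh dh) :
    γ * T ≤ 101 / 100 * (χ * S) := by
  have hw := logUnit_nonneg hu hu'
  have h1 := (fp.div_relClose hu hu' hS.ne' hng hdg).mono (k' := 50) hw (by norm_num)
  have h2 := (fp.div_relClose hu hu' hT.ne' hnh hdh).mono (k' := 50) hw (by norm_num)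
  have h3 := ((RelClose.iff_of_nonneg (by positivity)).1 ⟨h1, by positivity⟩).1
  have h4 := ((RelClose.iff_of_nonneg (by positivity)).1 ⟨h2, by positivity⟩).2.1
  have h5 := exp_logUnit_sub_one_le (k := 50) hu hu' (by norm_num) (by norm_num)
  have h6 : γ / S * Real.exp (-(50 * logUnit u)) ≤ χ / T * Real.exp (50 * logUnit u) := by linarith
  rw [Real.exp_neg, ← div_eq_mul_inv, div_le_iff₀ (Real.exp_pos _)] at h6
  set E := Real.exp (50 * logUnit u)
  have hE : E * E ≤ 101 / 100 := by
    have : E ≤ 1 + 51 / 10 ^ 6 := by linarith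
    have h0 : 0 < E := Real.exp_pos _
    nlinarith
  have h7 : γ / S ≤ χ / T * (101 / 100) := by
    refine h6.trans ?_
    rw [mul_assoc]
    gcongr
  rw [div_mul_eq_mul_div, div_le_div_iff₀ hS hT] at h7
  linarith

namespace FactorPair

variable {u μ ν : ℝ} {fp : FloatModel u} {G Gt G₀ Gh H Ht H₀ Hh : Mat2} {ng nh : ℝ}

theorem Gh_nonneg (F : FactorPair u μ ν G Gt G₀ Gh H Ht H₀ Hh) (i j : Fin 2) : 0 ≤ Gh i j :=
  (abs_nonneg _).trans (F.G_bound i j)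

theorem Hh_nonneg (F : FactorPair u μ ν G Gt G₀ Gh H Ht H₀ Hh) (i j : Fin 2) : 0 ≤ Hh i j :=
  (abs_nonneg _).trans (F.H_bound i j)

theorem add_abs_relClose (hu : 0 < u) (hu' : u ≤ 1 / 10 ^ 6) (fp : FloatModel u) (a b : ℝ) :
    RelClose u 1 (fp.add |a| |b|) (|a| + |b|) := by
  have hw := logUnit_nonneg hu hu'
  simpa using fp.add_relClose hu hu' le_rfl (RelClose.refl (x := |a|) hw le_rfl)
    (RelClose.refl (x := |b|) hw le_rfl) (by positivity)

theorem eq_zero_of_add_abs (hu : 0 < u) (hu' : u ≤ 1 / 10 ^ 6) {fp : FloatModel u} {a b : ℝ}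
    (h : fp.add |a| |b| = 0) : a = 0 ∧ b = 0 := by
  rw [(add_abs_relClose hu hu' fp a b).eq_zero_iff, add_eq_zero_iff_of_nonneg (abs_nonneg a)
    (abs_nonneg b), abs_eq_zero, abs_eq_zero] at h
  exact h

theorem pos_of_add_abs_ne (hu : 0 < u) (hu' : u ≤ 1 / 10 ^ 6) {fp : FloatModel u} {a b : ℝ}
    (h : fp.add |a| |b| ≠ 0) : 0 < |a| + |b| :=
  lt_of_le_of_ne (by positivity) (Ne.symm ((add_abs_relClose hu hu' fp a b).eq_zero_iff.not.1 h))

/-- The choice of the middle rotation that prefers the left factor. -/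
theorem exists_result_prefer_row (hu : 0 < u) (hu' : u ≤ 1 / 10 ^ 6)
    (F : FactorPair u μ ν G Gt G₀ Gh H Ht H₀ Hh) (hng : RelClose u 45 ng (Gh 0 0 + Gh 0 1))
    (hnh : RelClose u 45 nh (Hh 0 1 + Hh 1 1)) :
    ∃ Q, FactorPairResult u μ ν fp G G₀ H H₀
      (if fp.add |H 0 1| |H 1 1| = 0 ∨ (fp.add |G 0 0| |G 0 1| ≠ 0 ∧
          fp.div ng (fp.add |G 0 0| |G 0 1|) ≤ fp.div nh (fp.add |H 0 1| |H 1 1|))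
        then (rotCS (fp.lartg (G 0 0) (G 0 1)))ᵀ else rotCS (fp.lartg (H 1 1) (H 0 1))) Q := by
  have hγ := add_nonneg (F.Gh_nonneg 0 0) (F.Gh_nonneg 0 1)
  have hχ := add_nonneg (F.Hh_nonneg 0 1) (F.Hh_nonneg 1 1)
  have rg := add_abs_relClose hu hu' fp (G 0 0) (G 0 1)
  have rh := add_abs_relClose hu hu' fp (H 0 1) (H 1 1)
  by_cases hh : fp.add |H 0 1| |H 1 1| = 0
  · rw [if_pos (Or.inl hh)]
    exact F.exists_result_of_row hu hu' fp (Or.inl (eq_zero_of_add_abs hu hu' hh))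
  have hT := pos_of_add_abs_ne hu hu' hh
  by_cases hg : fp.add |G 0 0| |G 0 1| = 0
  · rw [if_neg (by tauto)]
    exact F.exists_result_of_col hu hu' fp (Or.inl (eq_zero_of_add_abs hu hu' hg))
  have hS := pos_of_add_abs_ne hu hu' hg
  split_ifs with h
  · exact F.exists_result_of_row hu hu' fp (Or.inr ⟨hS, fp.growth_le_of_div_le hu hu' hng hnh rg rh
      hγ hχ hS hT (h.resolve_left hh).2⟩)
  · rw [not_or, not_and, not_le] at h
    exact F.exists_result_of_col hu hu' fp (Or.inr ⟨hT, fp.growth_le_of_div_le hu hu' hnh hng rh rg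
      hχ hγ hT hS (h.2 hg).le⟩)

/-- The choice of the middle rotation that prefers the right factor. -/
theorem exists_result_prefer_col (hu : 0 < u) (hu' : u ≤ 1 / 10 ^ 6)
    (F : FactorPair u μ ν G Gt G₀ Gh H Ht H₀ Hh) (hng : RelClose u 45 ng (Gh 0 0 + Gh 0 1))
    (hnh : RelClose u 45 nh (Hh 0 1 + Hh 1 1)) :
    ∃ Q, FactorPairResult u μ ν fp G G₀ H H₀
      (if fp.add |G 0 0| |G 0 1| = 0 ∨ (fp.add |H 0 1| |H 1 1| ≠ 0 ∧
          fp.div nh (fp.add |H 0 1| |H 1 1|) ≤ fp.div ng (fp.add |G 0 0| |G 0 1|))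
        then rotCS (fp.lartg (H 1 1) (H 0 1)) else (rotCS (fp.lartg (G 0 0) (G 0 1)))ᵀ) Q := by
  have hγ := add_nonneg (F.Gh_nonneg 0 0) (F.Gh_nonneg 0 1)
  have hχ := add_nonneg (F.Hh_nonneg 0 1) (F.Hh_nonneg 1 1)
  have rg := add_abs_relClose hu hu' fp (G 0 0) (G 0 1)
  have rh := add_abs_relClose hu hu' fp (H 0 1) (H 1 1)
  by_cases hg : fp.add |G 0 0| |G 0 1| = 0
  · rw [if_pos (Or.inl hg)]
    exact F.exists_result_of_col hu hu' fp (Or.inl (eq_zero_of_add_abs hu hu' hg))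
  have hS := pos_of_add_abs_ne hu hu' hg
  by_cases hh : fp.add |H 0 1| |H 1 1| = 0
  · rw [if_neg (by tauto)]
    exact F.exists_result_of_row hu hu' fp (Or.inl (eq_zero_of_add_abs hu hu' hh))
  have hT := pos_of_add_abs_ne hu hu' hh
  split_ifs with h
  · exact F.exists_result_of_col hu hu' fp (Or.inr ⟨hT, fp.growth_le_of_div_le hu hu' hnh hng rh rg
      hχ hγ hT hS (h.resolve_left hg).2⟩)
  · rw [not_or, not_and, not_le] at h
    exact F.exists_result_of_row hu hu' fp (Or.inr ⟨hS, fp.growth_le_of_div_le hu hu' hng hnh rg rh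
      hγ hχ hS hT (h.2 hh).le⟩)

end FactorPair

/-! ### The computed product and its singular value decomposition -/

/-- Factorizations `M = Ct * Nt = Kt * Bt` with factors close to `C`, `adj(A) B`, `C adj(A)` and
`B`. -/
structure ProductFactors (u : ℝ) (A B C M Ct Nt Kt Bt : Mat2) : Prop where
  eq₁ : M = Ct * Nt
  eq₂ : M = Kt * Bt
  near_C : ∀ i j, NearBy u 4 (Ct i j) (C i j) (absM C i j)
  near_N : ∀ i j, NearBy u 4 (Nt i j) ((A.adjugate * B) i j) ((absM A.adjugate * absM B) i j)
  near_K : ∀ i j, NearBy u 4 (Kt i j) ((C * A.adjugate) i j) ((absM C * absM A.adjugate) i j)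
  near_B : ∀ i j, NearBy u 4 (Bt i j) (B i j) (absM B i j)
  C00 : Ct 0 0 = C 0 0
  C10 : Ct 1 0 = 0
  N10 : Nt 1 0 = 0
  N11 : Nt 1 1 = A 0 0 * B 1 1
  K00 : Kt 0 0 = C 0 0 * A 1 1
  K10 : Kt 1 0 = 0
  B10 : Bt 1 0 = 0
  B11 : Bt 1 1 = B 1 1

theorem NearBy.mul_factor {u k a y : ℝ} (hw : 0 ≤ logUnit u) (hk : 0 ≤ k) (h : RelClose u k y 1) :
    NearBy u k (a * y) a |a| := by
  have := (RelClose.refl (x := a) hw le_rfl).mul h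
  rw [zero_add, mul_one] at this
  exact .of_relClose hw hk this

/-- The rounding errors of the computed product can be attributed to either pair of factors: every
term of the expanded product carries its own error, which is assigned to an entry of one factor, or
to one of the two terms in the (1,2) entry of `adj(A) B` or `C adj(A)`. -/
theorem FloatModel.exists_productFactors {u : ℝ} (hu : 0 < u) (hu' : u ≤ 1 / 10 ^ 6)
    (fp : FloatModel u) {A B C : Mat2} (hA : A 1 0 = 0) (hB : B 1 0 = 0) (hC : C 1 0 = 0) :
    ∃ Ct Nt Kt Bt, ProductFactors u A B C (fp.prodM A B C) Ct Nt Kt Bt := by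
  have hw := logUnit_nonneg hu hu'
  obtain ⟨e1, he1, h1⟩ := fp.mul_err (C 0 0) (A 1 1)
  obtain ⟨e2, he2, h2⟩ := fp.mul_err (A 0 0) (B 1 1)
  obtain ⟨e3, he3, h3⟩ := fp.mul_err (fp.mul (C 0 0) (A 1 1)) (B 0 0)
  obtain ⟨e4, he4, h4⟩ := fp.mul_err (fp.mul (C 0 0) (A 1 1)) (B 0 1)
  obtain ⟨e5, he5, h5⟩ := fp.mul_err (C 0 1) (fp.mul (A 0 0) (B 1 1))
  obtain ⟨e6, he6, h6⟩ := fp.add_err (fp.mul (fp.mul (C 0 0) (A 1 1)) (B 0 1))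
    (fp.mul (C 0 1) (fp.mul (A 0 0) (B 1 1)))
  obtain ⟨e7, he7, h7⟩ := fp.mul_err (C 0 0) (A 0 1)
  obtain ⟨e8, he8, h8⟩ := fp.mul_err (fp.mul (C 0 0) (A 0 1)) (B 1 1)
  obtain ⟨e9, he9, h9⟩ := fp.sub_err (fp.add (fp.mul (fp.mul (C 0 0) (A 1 1)) (B 0 1))
    (fp.mul (C 0 1) (fp.mul (A 0 0) (B 1 1)))) (fp.mul (fp.mul (C 0 0) (A 0 1)) (B 1 1))
  obtain ⟨e10, he10, h10⟩ := fp.mul_err (C 1 1) (fp.mul (A 0 0) (B 1 1))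
  have r : ∀ {e : ℝ}, |e| ≤ u → RelClose u 1 (1 + e) 1 := fun he => by
    simpa using (RelClose.refl (x := 1) hw le_rfl).round hu hu' he
  obtain ⟨x₁, hx₁⟩ : ∃ x, x = (1 + e1) * (1 + e3) := ⟨_, rfl⟩
  obtain ⟨x₂, hx₂⟩ : ∃ x, x = (1 + e2) * (1 + e10) := ⟨_, rfl⟩
  obtain ⟨y₁, hy₁⟩ : ∃ x, x = (1 + e1) * (1 + e4) * (1 + e6) * (1 + e9) := ⟨_, rfl⟩
  obtain ⟨y₂, hy₂⟩ : ∃ x, x = (1 + e2) * (1 + e5) * (1 + e6) * (1 + e9) := ⟨_, rfl⟩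
  obtain ⟨y₃, hy₃⟩ : ∃ x, x = (1 + e7) * (1 + e8) * (1 + e9) := ⟨_, rfl⟩
  have rx₁ : RelClose u 4 x₁ 1 := by
    rw [hx₁]; simpa using ((r he1).mul (r he3)).mono (k' := 4) hw (by norm_num)
  have rx₂ : RelClose u 4 x₂ 1 := by
    rw [hx₂]; simpa using ((r he2).mul (r he10)).mono (k' := 4) hw (by norm_num)
  have ry₁ : RelClose u 4 y₁ 1 := by
    rw [hy₁]
    simpa using ((((r he1).mul (r he4)).mul (r he6)).mul (r he9)).mono (k' := 4) hw (by norm_num)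
  have ry₂ : RelClose u 4 y₂ 1 := by
    rw [hy₂]
    simpa using ((((r he2).mul (r he5)).mul (r he6)).mul (r he9)).mono (k' := 4) hw (by norm_num)
  have ry₃ : RelClose u 4 y₃ 1 := by
    rw [hy₃]
    simpa using (((r he7).mul (r he8)).mul (r he9)).mono (k' := 4) hw (by norm_num)
  have hM : fp.prodM A B C = !![C 0 0 * A 1 1 * B 0 0 * x₁,
      C 0 0 * A 1 1 * B 0 1 * y₁ + C 0 1 * A 0 0 * B 1 1 * y₂ - C 0 0 * A 0 1 * B 1 1 * y₃;
      0, C 1 1 * A 0 0 * B 1 1 * x₂] := by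
    unfold prodM
    dsimp only
    rw [h9, h6, h5, h4, h8, h3, h10, h1, h2, h7, hx₁, hx₂, hy₁, hy₂, hy₃]
    ext i j
    fin_cases i <;> fin_cases j <;> simp <;> ring
  have f : ∀ {a y : ℝ}, RelClose u 4 y 1 → NearBy u 4 (a * y) a |a| :=
    fun h => .mul_factor hw (by norm_num) h
  have z : ∀ a : ℝ, NearBy u 4 a a |a| := fun a => .refl hw (by norm_num)
  refine ⟨!![C 0 0, C 0 1 * y₂; 0, C 1 1 * x₂],
    !![A 1 1 * B 0 0 * x₁, A 1 1 * B 0 1 * y₁ - A 0 1 * B 1 1 * y₃; 0, A 0 0 * B 1 1],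
    !![C 0 0 * A 1 1, C 0 1 * A 0 0 * y₂ - C 0 0 * A 0 1 * y₃; 0, C 1 1 * A 0 0 * x₂],
    !![B 0 0 * x₁, B 0 1 * y₁; 0, B 1 1], ?_, ?_, ?_, ?_, ?_, ?_, rfl, rfl, rfl, rfl, rfl, rfl,
    rfl, rfl⟩
  · rw [hM]
    ext i j
    fin_cases i <;> fin_cases j <;> simp [Matrix.mul_apply, Fin.sum_univ_two] <;> ring
  · rw [hM]
    ext i j
    fin_cases i <;> fin_cases j <;> simp [Matrix.mul_apply, Fin.sum_univ_two] <;> ring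
  · intro i j
    fin_cases i <;> fin_cases j <;> simp [absM, hC]
    · exact z _
    · exact f ry₂
    · simpa using z 0
    · exact f rx₂
  · intro i j
    fin_cases i <;> fin_cases j <;>
      simp [absM, hB, hA, Matrix.adjugate_fin_two, Matrix.mul_apply, Fin.sum_univ_two]
    · rw [← abs_mul]; exact f rx₁
    · rw [← abs_mul, ← abs_mul]
      have := (f (a := A 1 1 * B 0 1) ry₁).add (f (a := -(A 0 1 * B 1 1)) ry₃)
      rw [abs_neg] at this
      convert this using 1
      ring
    · simpa using z 0
    · rw [← abs_mul]; exact z _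
  · intro i j
    fin_cases i <;> fin_cases j <;>
      simp [absM, hC, hA, Matrix.adjugate_fin_two, Matrix.mul_apply, Fin.sum_univ_two]
    · rw [← abs_mul]; exact z _
    · rw [← abs_mul, ← abs_mul]
      have := (f (a := -(C 0 0 * A 0 1)) ry₃).add (f (a := C 0 1 * A 0 0) ry₂)
      rw [abs_neg] at this
      convert this using 1
      ring
    · simpa using z 0
    · rw [← abs_mul]; exact f rx₂
  · intro i j
    fin_cases i <;> fin_cases j <;> simp [absM, hB]
    · exact f rx₁
    · exact f ry₁
    · simpa using z 0
    · exact z _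

/-- Computed rotations `Ub`, `Vb` that are componentwise close to those of an exact unnormalized
SVD of `M`. -/
structure SVDApprox (u : ℝ) (M U V Ub Vb : Mat2) : Prop where
  U₁ : Uᵀ * U = 1
  U₂ : U * Uᵀ = 1
  V₁ : Vᵀ * V = 1
  V₂ : V * Vᵀ = 1
  close_U : ∀ i j, RelClose u 40 (Ub i j) (U i j)
  close_V : ∀ i j, RelClose u 40 (Vb i j) (V i j)
  diag : (Vᵀ * M * U).IsDiag

theorem matJ_orthogonal : matJᵀ * matJ = 1 ∧ matJ * matJᵀ = 1 := by
  constructor <;> ext i j <;> fin_cases i <;> fin_cases j <;>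
    simp [matJ, Matrix.mul_apply, Fin.sum_univ_two]

theorem SVDApprox.mul_matJ {u : ℝ} {M U V Ub Vb : Mat2} (h : SVDApprox u M U V Ub Vb) :
    SVDApprox u M (U * matJ) (V * matJ) (Ub * matJ) (Vb * matJ) := by
  obtain ⟨j1, j2⟩ := matJ_orthogonal
  have o1 : ∀ X : Mat2, Xᵀ * X = 1 → (X * matJ)ᵀ * (X * matJ) = 1 := fun X hX => by
    rw [Matrix.transpose_mul, Matrix.mul_assoc, ← Matrix.mul_assoc Xᵀ, hX, Matrix.one_mul, j1]
  have o2 : ∀ X : Mat2, X * Xᵀ = 1 → (X * matJ) * (X * matJ)ᵀ = 1 := fun X hX => by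
    rw [Matrix.transpose_mul, Matrix.mul_assoc, ← Matrix.mul_assoc matJ, j2, Matrix.one_mul, hX]
  have c : ∀ X Y : Mat2, (∀ i j, RelClose u 40 (X i j) (Y i j)) →
      ∀ i j, RelClose u 40 ((X * matJ) i j) ((Y * matJ) i j) := by
    intro X Y hXY i j
    fin_cases j <;> simp [matJ, Matrix.mul_apply, Fin.sum_univ_two]
    · exact (hXY i 1).neg
    · exact hXY i 0
  refine ⟨o1 U h.U₁, o2 U h.U₂, o1 V h.V₁, o2 V h.V₂, c _ _ h.close_U, c _ _ h.close_V, ?_⟩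
  have e : (V * matJ)ᵀ * M * (U * matJ) = matJᵀ * (Vᵀ * M * U) * matJ := by
    simp only [Matrix.transpose_mul, Matrix.mul_assoc]
  rw [e]
  have h01 : (Vᵀ * M * U) 0 1 = 0 := h.diag (show (0 : Fin 2) ≠ 1 by decide)
  have h10 : (Vᵀ * M * U) 1 0 = 0 := h.diag (show (1 : Fin 2) ≠ 0 by decide)
  generalize Vᵀ * M * U = D at *
  intro i j hij
  fin_cases i <;> fin_cases j <;>
    simp [matJ, Matrix.mul_apply, Fin.sum_univ_two] at hij ⊢ <;>
    assumption

/-- The computed `U` and `V` are accurate. The second singular value is the one that vanishes when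
`c₁₁ = 0` or `b₂₂ = 0`. -/
theorem FloatModel.exists_svdApprox {u : ℝ} (hu : 0 < u) (hu' : u ≤ 1 / 10 ^ 6)
    (fp : FloatModel u) (A B C : Mat2) :
    ∃ U V, SVDApprox u (fp.prodM A B C) U V (fp.rsvdUV A B C).1 (fp.rsvdUV A B C).2 ∧
      (C 0 0 = 0 ∨ B 1 1 = 0 → (Vᵀ * fp.prodM A B C * U) 1 1 = 0) := by
  have h10 : fp.prodM A B C 1 0 = 0 := rfl
  have hsing : C 0 0 = 0 ∨ B 1 1 = 0 → fp.prodM A B C 0 0 = 0 ∨ fp.prodM A B C 1 1 = 0 := by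
    rintro (h | h)
    · left; simp [prodM, h, fp.zero_mul]
    · right; simp [prodM, h, fp.mul_zero]
  unfold rsvdUV
  dsimp only
  generalize fp.prodM A B C = M at *
  obtain ⟨cl, sl, cr, sr, H, h1, h2, h3, h4⟩ := fp.lasv2_relClose hu hu' (M 0 0) (M 0 1) (M 1 1)
  generalize fp.lasv2 (M 0 0) (M 0 1) (M 1 1) = w at *
  have hU := rotCS_orthogonal H.right
  have hV := rotCS_orthogonal H.left
  have S : SVDApprox u M (rotCS (cr, sr))ᵀ (rotCS (cl, sl))ᵀ (rotCS w.2)ᵀ (rotCS w.1)ᵀ := by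
    refine ⟨by simpa using hU.2, by simpa using hU.1, by simpa using hV.2, by simpa using hV.1,
      fun i j => relClose_rotCS h3 h4 j i, fun i j => relClose_rotCS h1 h2 j i, ?_⟩
    intro i j hij
    have o1 := H.off₁
    have o2 := H.off₂
    fin_cases i <;> fin_cases j <;>
      simp [rotCS, Matrix.mul_apply, Matrix.vecMul, dotProduct, Fin.sum_univ_two, h10] at hij ⊢ <;>
      linarith
  split_ifs with hswap
  · refine ⟨_, _, S.mul_matJ, ?_⟩
    rintro (h | h)
    · exact absurd h hswap.1
    · exact absurd h hswap.2.2.2.1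
  · refine ⟨_, _, S, fun h => ?_⟩
    have o := H.diag₂ (hsing h)
    simp [rotCS, Matrix.mul_apply, Matrix.vecMul, dotProduct, Fin.sum_univ_two, h10]
    linarith

/-! ### Backward stability -/

theorem matMul_nearBy {u k k' : ℝ} (hw : 0 ≤ logUnit u) (hk : 0 ≤ k) (hk' : 0 ≤ k')
    {X X' Xh Y Y' Yh : Mat2} (hX : ∀ i j, NearBy u k (X i j) (X' i j) (Xh i j))
    (hY : ∀ i j, NearBy u k' (Y i j) (Y' i j) (Yh i j)) (i j : Fin 2) :
    NearBy u (k + k') ((X * Y) i j) ((X' * Y') i j) ((Xh * Yh) i j) := by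
  simp only [Matrix.mul_apply, Fin.sum_univ_two]
  exact ((hX i 0).mul hw hk hk' (hY 0 j)).add ((hX i 1).mul hw hk hk' (hY 1 j))

/-- An entry that was computed with 44 roundings, or replaced by that of the perturbed factor, is close
to the entries of the perturbed and of the exact factor. -/
theorem close_of_nearBy_or_eq {u x xt x₀ xh : ℝ} (hu : 0 < u) (hu' : u ≤ 1 / 10 ^ 6)
    (h : NearBy u 44 x x₀ xh ∨ x = xt) (ht : NearBy u 4 xt x₀ xh) :
    |x - xt| ≤ 50 * u * xh ∧ |x - x₀| ≤ 50 * u * xh := by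
  have h0 := (abs_nonneg _).trans ht.2
  have e1 := exp_logUnit_sub_one_le (k := 44) hu hu' (by norm_num) (by norm_num)
  have e2 := exp_logUnit_sub_one_le (k := 4) hu hu' (by norm_num) (by norm_num)
  have b1 := mul_le_mul_of_nonneg_right e1 h0
  have b2 := mul_le_mul_of_nonneg_right e2 h0
  have hux : 0 ≤ u * xh := by positivity
  have ht1 := ht.1
  rcases h with h | rfl
  · have h1 := h.1
    have := abs_sub_le x x₀ xt
    rw [abs_sub_comm x₀ xt] at this
    constructor <;> linarith
  · rw [sub_self, abs_zero]
    constructor <;> linarith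

theorem FactorPair.of_nearBy {u μ ν : ℝ} (hu : 0 < u) (hu' : u ≤ 1 / 10 ^ 6) (hμ : 0 ≤ μ)
    (hν : 0 ≤ ν) {G Gt G₀ Gh H Ht H₀ Hh : Mat2}
    (hG : ∀ i j, NearBy u 44 (G i j) (G₀ i j) (Gh i j) ∨ G i j = Gt i j)
    (hGt : ∀ i j, NearBy u 4 (Gt i j) (G₀ i j) (Gh i j))
    (hH : ∀ i j, NearBy u 44 (H i j) (H₀ i j) (Hh i j) ∨ H i j = Ht i j)
    (hHt : ∀ i j, NearBy u 4 (Ht i j) (H₀ i j) (Hh i j))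
    (hrow : ∀ i, Gh i 0 ^ 2 + Gh i 1 ^ 2 ≤ μ ^ 2) (hcol : ∀ j, Hh 0 j ^ 2 + Hh 1 j ^ 2 ≤ ν ^ 2)
    (hd : (Gt * Ht).IsDiag) : FactorPair u μ ν G Gt G₀ Gh H Ht H₀ Hh where
  μ_nonneg := hμ
  ν_nonneg := hν
  G_tilde i j := (close_of_nearBy_or_eq hu hu' (hG i j) (hGt i j)).1
  G_exact i j := (close_of_nearBy_or_eq hu hu' (hG i j) (hGt i j)).2
  G_bound i j := (hGt i j).2
  G_row := hrow
  H_tilde i j := (close_of_nearBy_or_eq hu hu' (hH i j) (hHt i j)).1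
  H_exact i j := (close_of_nearBy_or_eq hu hu' (hH i j) (hHt i j)).2
  H_bound i j := (hHt i j).2
  H_col := hcol
  diag := hd

/-- The bounds from which the stability theorem follows: the outputs are close to products with the
same exact orthogonal matrices. -/
structure StableOutput (u : ℝ) (A B C M Ub Vb B' C' H' K' U V P Q : Mat2) : Prop where
  U₁ : Uᵀ * U = 1
  V₁ : Vᵀ * V = 1
  P₁ : Pᵀ * P = 1
  Q₁ : Qᵀ * Q = 1
  M_diag : (Vᵀ * M * U).IsDiag
  near_M : ‖Vbᵀ * M * Ub - Vᵀ * M * U‖ ≤ 132 * u * ‖M‖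
  near_B : ‖B' - Pᵀ * (B * U)‖ ≤ 480 * u * ‖B‖
  near_C : ‖C' - Vᵀ * C * Q‖ ≤ 480 * u * ‖C‖
  near_H : ‖H' - Qᵀ * (A.adjugate * (B * U))‖ ≤ 480 * u * (‖A‖ * ‖B‖)
  near_K : ‖K' - Vᵀ * C * A.adjugate * P‖ ≤ 480 * u * (‖A‖ * ‖C‖)
  diag_CH : ∃ X Y : Mat2, ‖X‖ ≤ 80 * u * ‖C‖ ∧ ‖Y‖ ≤ 80 * u * (‖A‖ * ‖B‖) ∧
    ((C' + X) * (H' + Y)).IsDiag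
  diag_KB : ∃ X Y : Mat2, ‖X‖ ≤ 80 * u * (‖A‖ * ‖C‖) ∧ ‖Y‖ ≤ 80 * u * ‖B‖ ∧
    ((K' + X) * (B' + Y)).IsDiag

theorem SVDApprox.norm_sub_le {u : ℝ} (hu : 0 < u) (hu' : u ≤ 1 / 10 ^ 6) {M U V Ub Vb : Mat2}
    (h : SVDApprox u M U V Ub Vb) : ‖Vbᵀ * M * Ub - Vᵀ * M * U‖ ≤ 132 * u * ‖M‖ := by
  have hw := logUnit_nonneg hu hu'
  have e1 := exp_logUnit_sub_one_le (k := 40) hu hu' (by norm_num) (by norm_num)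
  have key : ∀ X Y : Mat2, Xᵀ * X = 1 → (∀ i j, RelClose u 40 (Y i j) (X i j)) →
      ‖Y - X‖ ≤ 58 * u := by
    intro X Y hX hXY
    refine Mat2.norm_le_of_sum_sq_le _ (by positivity) ?_
    have b : ∀ i j, (Y i j - X i j) ^ 2 ≤ (41 * u) ^ 2 * X i j ^ 2 := by
      intro i j
      have h1 := (NearBy.of_relClose hw (by norm_num) (hXY i j)).1
      have h2 : |Y i j - X i j| ≤ 41 * u * |X i j| :=
        h1.trans (mul_le_mul_of_nonneg_right (by linarith) (abs_nonneg _))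
      rw [← sq_abs (Y i j - X i j), ← sq_abs (X i j), ← mul_pow]
      exact pow_le_pow_left₀ (abs_nonneg _) h2 2
    have c0 := Mat2.col_sq_of_orthogonal hX 0
    have c1 := Mat2.col_sq_of_orthogonal hX 1
    have b00 := b 0 0
    have b01 := b 0 1
    have b10 := b 1 0
    have b11 := b 1 1
    simp only [Matrix.sub_apply]
    nlinarith [sq_nonneg u]
  have hU := key U Ub h.U₁ h.close_U
  have hV := key V Vb h.V₁ h.close_V
  have hV1 := Mat2.norm_le_one_of_orthogonal h.V₁
  have hU1 := Mat2.norm_le_one_of_orthogonal h.U₁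
  have hUb : ‖Ub‖ ≤ 1 + 58 * u := by
    have := norm_add_le (Ub - U) U
    rw [sub_add_cancel] at this
    linarith
  have e : Vbᵀ * M * Ub - Vᵀ * M * U = (Vb - V)ᵀ * M * Ub + Vᵀ * M * (Ub - U) := by
    rw [Matrix.transpose_sub]
    noncomm_ring
  rw [e]
  have m : ∀ (X Y : Mat2) {α β : ℝ}, 0 ≤ α → ‖X‖ ≤ α → ‖Y‖ ≤ β →
      ‖Xᵀ * M * Y‖ ≤ α * ‖M‖ * β := by
    intro X Y α β h0 hα hβ
    refine (Matrix.l2_opNorm_mul _ _).trans ?_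
    refine mul_le_mul ((Matrix.l2_opNorm_mul _ _).trans ?_) hβ (norm_nonneg _) (by positivity)
    rw [Mat2.norm_transpose]
    gcongr
  have b1 := m (Vb - V) Ub (by positivity) hV hUb
  have b2 := m V (Ub - U) zero_le_one hV1 hU
  refine (norm_add_le _ _).trans ((add_le_add b1 b2).trans ?_)
  have : 0 ≤ u * ‖M‖ := by positivity
  nlinarith

/-- If the (2,2) entry of a product with an upper-triangular left factor vanishes, but not that of the
right factor, then that of the left factor does. -/
theorem entry_eq_zero_of_row {X Y : Mat2} (h : (X * Y) 1 1 = 0) (hX : X 1 0 = 0)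
    (hY : Y 1 1 ≠ 0) : X 1 1 = 0 := by
  rw [Matrix.mul_apply, Fin.sum_univ_two, hX, zero_mul, zero_add] at h
  exact (mul_eq_zero.mp h).resolve_right hY

theorem entry_eq_zero_of_col {X Y : Mat2} (h : (X * Y) 0 1 = 0) (hX : X 0 0 ≠ 0)
    (hY : Y 1 1 = 0) : Y 0 1 = 0 := by
  rw [Matrix.mul_apply, Fin.sum_univ_two, hY, mul_zero, add_zero] at h
  exact (mul_eq_zero.mp h).resolve_left hX

namespace SVDApprox

variable {u : ℝ} {M U V Ub Vb : Mat2}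

theorem transpose_mul_eq_zero (h : SVDApprox u M U V Ub Vb) (h11 : (Vᵀ * M * U) 1 1 = 0) :
    (Vᵀ * M) 1 1 = 0 := by
  have h10 : (Vᵀ * M * U) 1 0 = 0 := h.diag (show (1 : Fin 2) ≠ 0 by decide)
  have e : Vᵀ * M = Vᵀ * M * U * Uᵀ := by rw [Matrix.mul_assoc _ U, h.U₂, Matrix.mul_one]
  rw [e, Matrix.mul_apply, Fin.sum_univ_two, h10, h11, zero_mul, zero_mul, add_zero]

theorem mul_eq_zero (h : SVDApprox u M U V Ub Vb) (h11 : (Vᵀ * M * U) 1 1 = 0) :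
    (M * U) 0 1 = 0 := by
  have h01 : (Vᵀ * M * U) 0 1 = 0 := h.diag (show (0 : Fin 2) ≠ 1 by decide)
  have e : M * U = V * (Vᵀ * M * U) := by
    rw [← Matrix.mul_assoc, ← Matrix.mul_assoc, h.V₂, Matrix.one_mul]
  rw [e, Matrix.mul_apply, Fin.sum_univ_two, h01, h11, mul_zero, mul_zero, add_zero]

end SVDApprox

theorem sum_sq_abs_col {X : Mat2} (h : Xᵀ * X = 1) (j : Fin 2) :
    absM X 0 j ^ 2 + absM X 1 j ^ 2 = 1 := by
  simpa [absM] using Mat2.col_sq_of_orthogonal h j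

/-- Stability in the generic case. -/
theorem FloatModel.rsvdGeneric_stable {u : ℝ} (hu : 0 < u) (hu' : u ≤ 1 / 10 ^ 6)
    (fp : FloatModel u) {A B C : Mat2} (hA : A 1 0 = 0) (hB : B 1 0 = 0) (hC : C 1 0 = 0)
    (hdet : A.det ≠ 0) (hBC : ¬ (C 0 0 = 0 ∧ B 1 1 = 0)) (zg zl : Bool) {out : RSVD22Output}
    (hout : out = fp.rsvdGeneric A B C zg zl) :
    ∃ U V P Q, StableOutput u A B C (fp.prodM A B C) out.U out.V out.B' out.C'
      (zero12 (fp.mulM out.Qᵀ out.H)) (zero12 (fp.mulM out.K out.P)) U V P Q := by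
  have hw := logUnit_nonneg hu hu'
  rw [Matrix.det_fin_two, hA, MulZeroClass.mul_zero, sub_zero] at hdet
  have hA00 : A 0 0 ≠ 0 := left_ne_zero_of_mul hdet
  have hA11 : A 1 1 ≠ 0 := right_ne_zero_of_mul hdet
  obtain ⟨U, V, S, hσ⟩ := fp.exists_svdApprox hu hu' A B C
  obtain ⟨Ct, Nt, Kt, Bt, F⟩ := fp.exists_productFactors hu hu' hA hB hC
  generalize hM : fp.prodM A B C = M at *
  subst hout
  unfold rsvdGeneric
  dsimp only
  generalize (fp.rsvdUV A B C).1 = Ub at *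
  generalize (fp.rsvdUV A B C).2 = Vb at *
  have z : ∀ X : Mat2, ∀ i j, NearBy u 0 (X i j) (X i j) (absM X i j) :=
    fun X i j => .refl hw le_rfl
  have zr : ∀ X : Mat2, ∀ i j, RelClose u 0 (absM X i j) (absM X i j) :=
    fun X i j => .refl hw le_rfl
  have hJ : A.adjugate 1 0 = 0 := by rw [Matrix.adjugate_fin_two]; simp [hA]
  have hJn : ‖absM A.adjugate‖ ≤ ‖A‖ :=
    (Mat2.norm_absM_le _ hJ).trans (Mat2.norm_adjugate_le A)
  have hBn := Mat2.norm_absM_le B hB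
  have hCn := Mat2.norm_absM_le C hC
  -- norms of the entrywise bounds
  have rowG : ∀ i, ((absM V)ᵀ * absM C) i 0 ^ 2 + ((absM V)ᵀ * absM C) i 1 ^ 2 ≤ ‖C‖ ^ 2 := by
    intro i
    refine (Mat2.row_mul_sq_le _ _ i).trans ?_
    rw [Matrix.transpose_apply, Matrix.transpose_apply, sum_sq_abs_col S.V₁, _root_.mul_one]
    exact pow_le_pow_left₀ (norm_nonneg _) hCn 2
  have colL : ∀ j, (absM B * absM U) 0 j ^ 2 + (absM B * absM U) 1 j ^ 2 ≤ ‖B‖ ^ 2 := by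
    intro j
    refine (Mat2.col_mul_sq_le _ _ j).trans ?_
    rw [sum_sq_abs_col S.U₁, _root_.mul_one]
    exact pow_le_pow_left₀ (norm_nonneg _) hBn 2
  have rowK : ∀ i, ((absM V)ᵀ * absM C * absM A.adjugate) i 0 ^ 2 +
      ((absM V)ᵀ * absM C * absM A.adjugate) i 1 ^ 2 ≤ (‖A‖ * ‖C‖) ^ 2 := by
    intro i
    refine (Mat2.row_mul_sq_le _ _ i).trans ?_
    rw [mul_pow]
    exact mul_le_mul (pow_le_pow_left₀ (norm_nonneg _) hJn 2) (rowG i) (by positivity)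
      (by positivity)
  have colH : ∀ j, (absM A.adjugate * (absM B * absM U)) 0 j ^ 2 +
      (absM A.adjugate * (absM B * absM U)) 1 j ^ 2 ≤ (‖A‖ * ‖B‖) ^ 2 := by
    intro j
    refine (Mat2.col_mul_sq_le _ _ j).trans ?_
    rw [mul_pow]
    exact mul_le_mul (pow_le_pow_left₀ (norm_nonneg _) hJn 2) (colL j) (by positivity)
      (by positivity)
  -- the factors of the decomposition of the computed product
  have Vt0 : ∀ i j, NearBy u 0 (Vᵀ i j) (Vᵀ i j) ((absM V)ᵀ i j) := fun i j => z V j i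
  have nGt : ∀ i j, NearBy u 4 ((Vᵀ * Ct) i j) ((Vᵀ * C) i j) (((absM V)ᵀ * absM C) i j) :=
    fun i j => by simpa using matMul_nearBy hw le_rfl (by norm_num) Vt0 F.near_C i j
  have nKt : ∀ i j, NearBy u 4 ((Vᵀ * Kt) i j) ((Vᵀ * C * A.adjugate) i j)
      (((absM V)ᵀ * absM C * absM A.adjugate) i j) := fun i j => by
    rw [Matrix.mul_assoc, Matrix.mul_assoc]
    simpa using matMul_nearBy hw le_rfl (by norm_num) Vt0 F.near_K i j
  have nLt : ∀ i j, NearBy u 4 ((Bt * U) i j) ((B * U) i j) ((absM B * absM U) i j) :=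
    fun i j => by simpa using matMul_nearBy hw (by norm_num) le_rfl F.near_B (z U) i j
  have nHt : ∀ i j, NearBy u 4 ((Nt * U) i j) ((A.adjugate * (B * U)) i j)
      ((absM A.adjugate * (absM B * absM U)) i j) := fun i j => by
    rw [← Matrix.mul_assoc, ← Matrix.mul_assoc]
    simpa using matMul_nearBy hw (by norm_num) le_rfl F.near_N (z U) i j
  have dGH : (Vᵀ * Ct * (Nt * U)).IsDiag := by
    have := S.diag
    rw [F.eq₁] at this
    simpa only [Matrix.mul_assoc] using this
  have dKL : (Vᵀ * Kt * (Bt * U)).IsDiag := by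
    have := S.diag
    rw [F.eq₂] at this
    simpa only [Matrix.mul_assoc] using this
  -- the computed factors
  have nV : ∀ i j, NearBy u 40 (Vbᵀ i j) (Vᵀ i j) ((absM V)ᵀ i j) :=
    fun i j => .of_relClose hw (by norm_num) (S.close_V j i)
  have nU : ∀ i j, NearBy u 40 (Ub i j) (U i j) (absM U i j) :=
    fun i j => .of_relClose hw (by norm_num) (S.close_U i j)
  have nG : ∀ i j, NearBy u 42 (fp.mulM Vbᵀ C i j) ((Vᵀ * C) i j) (((absM V)ᵀ * absM C) i j) :=
    fun i j => (fp.mulM_nearBy hu hu' (by norm_num) le_rfl nV (z C) i j).mono hw (by norm_num)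
  have nK : ∀ i j, NearBy u 44 (fp.mulM (fp.mulM Vbᵀ C) A.adjugate i j)
      ((Vᵀ * C * A.adjugate) i j) (((absM V)ᵀ * absM C * absM A.adjugate) i j) :=
    fun i j => (fp.mulM_nearBy hu hu' (by norm_num) le_rfl nG (z _) i j).mono hw (by norm_num)
  have nL : ∀ i j, NearBy u 42 (fp.mulM B Ub i j) ((B * U) i j) ((absM B * absM U) i j) :=
    fun i j => (fp.mulM_nearBy hu hu' le_rfl (by norm_num) (z B) nU i j).mono hw (by norm_num)
  have nH : ∀ i j, NearBy u 44 (fp.mulM A.adjugate (fp.mulM B Ub) i j)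
      ((A.adjugate * (B * U)) i j) ((absM A.adjugate * (absM B * absM U)) i j) :=
    fun i j => (fp.mulM_nearBy hu hu' le_rfl (by norm_num) (z _) nL i j).mono hw (by norm_num)
  -- the optional zeroing of `G` replaces entries by those of the perturbed factors
  obtain ⟨G, hG, cG, cK⟩ : ∃ G : Mat2,
      (if zg = true ∧ C 0 0 = 0 then zero22 (fp.mulM Vbᵀ C) else fp.mulM Vbᵀ C) = G ∧
      (∀ i j, NearBy u 44 (G i j) ((Vᵀ * C) i j) (((absM V)ᵀ * absM C) i j) ∨
        G i j = (Vᵀ * Ct) i j) ∧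
      (∀ i j, NearBy u 44 (fp.mulM G A.adjugate i j) ((Vᵀ * C * A.adjugate) i j)
        (((absM V)ᵀ * absM C * absM A.adjugate) i j) ∨
        fp.mulM G A.adjugate i j = (Vᵀ * Kt) i j) := by
    refine ⟨_, rfl, ?_⟩
    split_ifs with hz
    · have hB11 : B 1 1 ≠ 0 := fun h => hBC ⟨hz.2, h⟩
      have h11 := S.transpose_mul_eq_zero (hσ (Or.inl hz.2))
      have G10 : (Vᵀ * Ct) 1 0 = 0 := by
        simp [Matrix.mul_apply, Fin.sum_univ_two, F.C00, F.C10, hz.2]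
      have K10 : (Vᵀ * Kt) 1 0 = 0 := by
        simp [Matrix.mul_apply, Fin.sum_univ_two, F.K00, F.K10, hz.2]
      have G11 : (Vᵀ * Ct) 1 1 = 0 := by
        rw [F.eq₁, ← Matrix.mul_assoc] at h11
        exact entry_eq_zero_of_row h11 G10 (by rw [F.N11]; exact mul_ne_zero hA00 hB11)
      have K11 : (Vᵀ * Kt) 1 1 = 0 := by
        rw [F.eq₂, ← Matrix.mul_assoc] at h11
        exact entry_eq_zero_of_row h11 K10 (by rwa [F.B11])
      have g10 : fp.mulM Vbᵀ C 1 0 = 0 := by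
        simp [mulM, hC, hz.2, fp.mul_zero, fp.add_zero_zero]
      constructor
      · intro i j
        fin_cases i <;> fin_cases j
        · exact Or.inl ((nG 0 0).mono hw (by norm_num))
        · exact Or.inl ((nG 0 1).mono hw (by norm_num))
        · exact Or.inl ((nG 1 0).mono hw (by norm_num))
        · exact Or.inr G11.symm
      · intro i j
        fin_cases i <;> fin_cases j
        · exact Or.inl (nK 0 0)
        · exact Or.inl (nK 0 1)
        · right
          refine Eq.trans ?_ K10.symm
          change fp.add (fp.mul (fp.mulM Vbᵀ C 1 0) _) (fp.mul 0 _) = 0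
          rw [g10, fp.zero_mul, fp.zero_mul, fp.add_zero_zero]
        · right
          refine Eq.trans ?_ K11.symm
          change fp.add (fp.mul (fp.mulM Vbᵀ C 1 0) _) (fp.mul 0 _) = 0
          rw [g10, fp.zero_mul, fp.zero_mul, fp.add_zero_zero]
    · exact ⟨fun i j => Or.inl ((nG i j).mono hw (by norm_num)), fun i j => Or.inl (nK i j)⟩
  rw [hG]
  -- likewise for `L`
  obtain ⟨L, hL, cL, cH⟩ : ∃ L : Mat2,
      (if zl = true ∧ B 1 1 = 0 then zero12 (fp.mulM B Ub) else fp.mulM B Ub) = L ∧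
      (∀ i j, NearBy u 44 (L i j) ((B * U) i j) ((absM B * absM U) i j) ∨
        L i j = (Bt * U) i j) ∧
      (∀ i j, NearBy u 44 (fp.mulM A.adjugate L i j) ((A.adjugate * (B * U)) i j)
        ((absM A.adjugate * (absM B * absM U)) i j) ∨
        fp.mulM A.adjugate L i j = (Nt * U) i j) := by
    refine ⟨_, rfl, ?_⟩
    split_ifs with hz
    · have hC00 : C 0 0 ≠ 0 := fun h => hBC ⟨h, hz.2⟩
      have h01 := S.mul_eq_zero (hσ (Or.inr hz.2))
      have L11 : (Bt * U) 1 1 = 0 := by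
        simp [Matrix.mul_apply, Fin.sum_univ_two, F.B10, F.B11, hz.2]
      have H11 : (Nt * U) 1 1 = 0 := by
        simp [Matrix.mul_apply, Fin.sum_univ_two, F.N10, F.N11, hz.2]
      have L01 : (Bt * U) 0 1 = 0 := by
        rw [F.eq₂, Matrix.mul_assoc] at h01
        exact entry_eq_zero_of_col h01 (by rw [F.K00]; exact mul_ne_zero hC00 hA11) L11
      have H01 : (Nt * U) 0 1 = 0 := by
        rw [F.eq₁, Matrix.mul_assoc] at h01
        exact entry_eq_zero_of_col h01 (by rwa [F.C00]) H11
      have l11 : fp.mulM B Ub 1 1 = 0 := by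
        simp [mulM, hB, hz.2, fp.zero_mul, fp.add_zero_zero]
      constructor
      · intro i j
        fin_cases i <;> fin_cases j
        · exact Or.inl ((nL 0 0).mono hw (by norm_num))
        · exact Or.inr L01.symm
        · exact Or.inl ((nL 1 0).mono hw (by norm_num))
        · exact Or.inl ((nL 1 1).mono hw (by norm_num))
      · intro i j
        fin_cases i <;> fin_cases j
        · exact Or.inl (nH 0 0)
        · right
          refine Eq.trans ?_ H01.symm
          change fp.add (fp.mul _ 0) (fp.mul _ (fp.mulM B Ub 1 1)) = 0
          rw [l11, fp.mul_zero, fp.mul_zero, fp.add_zero_zero]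
        · exact Or.inl (nH 1 0)
        · right
          refine Eq.trans ?_ H11.symm
          change fp.add (fp.mul _ 0) (fp.mul _ (fp.mulM B Ub 1 1)) = 0
          rw [l11, fp.mul_zero, fp.mul_zero, fp.add_zero_zero]
    · exact ⟨fun i j => Or.inl ((nL i j).mono hw (by norm_num)), fun i j => Or.inl (nH i j)⟩
  rw [hL]
  have FGH := FactorPair.of_nearBy hu hu' (norm_nonneg C)
    (mul_nonneg (norm_nonneg A) (norm_nonneg B)) cG nGt cH nHt rowG colH dGH
  have FKL := FactorPair.of_nearBy hu hu' (mul_nonneg (norm_nonneg A) (norm_nonneg C))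
    (norm_nonneg B) cK nKt cL nLt rowK colL dKL
  -- the computed numerators of the growth factors
  have n0 : ∀ (X : Mat2) (i j : Fin 2), 0 ≤ absM X i j := fun X i j => abs_nonneg _
  have rG := fp.mulM_relClose_of_nonneg hu hu' (by norm_num) le_rfl (X := (absM Vb)ᵀ)
    (X' := (absM V)ᵀ) (fun i j => (S.close_V j i).abs) (zr C) (fun i j => n0 V j i) (n0 C)
  have rL := fp.mulM_relClose_of_nonneg hu hu' le_rfl (by norm_num) (Y := absM Ub)
    (Y' := absM U) (zr B) (fun i j => (S.close_U i j).abs) (n0 B) (n0 U)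
  have rK := fp.mulM_relClose_of_nonneg hu hu' (by norm_num) le_rfl rG (zr A.adjugate)
    (fun i j => FGH.Gh_nonneg i j) (n0 _)
  have rH := fp.mulM_relClose_of_nonneg hu hu' le_rfl (by norm_num) (zr A.adjugate) rL
    (n0 _) (fun i j => FKL.Hh_nonneg i j)
  have sG := (fp.add_relClose hu hu' (by norm_num) (rG 0 0) (rG 0 1)
    (mul_nonneg (FGH.Gh_nonneg 0 0) (FGH.Gh_nonneg 0 1))).mono (k' := 45) hw (by norm_num)
  have sH := (fp.add_relClose hu hu' (by norm_num) (rH 0 1) (rH 1 1)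
    (mul_nonneg (FGH.Hh_nonneg 0 1) (FGH.Hh_nonneg 1 1))).mono (k' := 45) hw (by norm_num)
  have sK := (fp.add_relClose hu hu' (by norm_num) (rK 0 0) (rK 0 1)
    (mul_nonneg (FKL.Gh_nonneg 0 0) (FKL.Gh_nonneg 0 1))).mono (k' := 45) hw (by norm_num)
  have sL := (fp.add_relClose hu hu' (by norm_num) (rL 0 1) (rL 1 1)
    (mul_nonneg (FKL.Hh_nonneg 0 1) (FKL.Hh_nonneg 1 1))).mono (k' := 45) hw (by norm_num)
  obtain ⟨Q, RQ⟩ := FGH.exists_result_prefer_row (fp := fp) hu hu' sG sH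
  obtain ⟨P, RP⟩ := FKL.exists_result_prefer_col (fp := fp) hu hu' sK sL
  exact ⟨U, V, P, Q, S.U₁, S.V₁, RP.orth, RQ.orth, S.diag,
    S.norm_sub_le hu hu', RP.right, RQ.left, RQ.right, RP.left, RQ.near_diag, RP.near_diag⟩

/-- Error bound for a product in which an entry that vanishes in exact arithmetic is set to zero. -/
theorem norm_sub_le_of_nearBy_or_eq {u m : ℝ} (hu : 0 < u) (hu' : u ≤ 1 / 10 ^ 6) (hm : 0 ≤ m)
    {Z W Wh : Mat2} (h : ∀ i j, NearBy u 10 (Z i j) (W i j) (Wh i j) ∨ Z i j = W i j)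
    (hn : Wh 0 0 ^ 2 + Wh 0 1 ^ 2 + Wh 1 0 ^ 2 + Wh 1 1 ^ 2 ≤ 8 * m ^ 2) :
    ‖Z - W‖ ≤ 480 * u * m := by
  have e := exp_logUnit_sub_one_le (k := 10) hu hu' (by norm_num) (by norm_num)
  have b : ∀ i j, (Z i j - W i j) ^ 2 ≤ (11 * u) ^ 2 * Wh i j ^ 2 := by
    intro i j
    rcases h i j with h | h
    · have h0 := (abs_nonneg _).trans h.2
      have h2 : |Z i j - W i j| ≤ 11 * u * Wh i j :=
        h.1.trans (mul_le_mul_of_nonneg_right (by linarith) h0)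
      rw [← sq_abs, ← mul_pow]
      exact pow_le_pow_left₀ (abs_nonneg _) h2 2
    · rw [h, sub_self, zero_pow two_ne_zero]; positivity
  refine Mat2.norm_le_of_sum_sq_le _ (by positivity) ?_
  have b00 := b 0 0
  have b01 := b 0 1
  have b10 := b 1 0
  have b11 := b 1 1
  have f := mul_le_mul_of_nonneg_left hn (sq_nonneg u)
  have g : 0 ≤ u ^ 2 * m ^ 2 := by positivity
  simp only [Matrix.sub_apply]
  nlinarith

/-- Stability in the case `c₁₁ = b₂₂ = 0`, where the computed product vanishes. -/
theorem FloatModel.rsvdSpecial_stable {u : ℝ} (hu : 0 < u) (hu' : u ≤ 1 / 10 ^ 6)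
    (fp : FloatModel u) {A B C : Mat2} (hA : A 1 0 = 0) (hB : B 1 0 = 0) (hC : C 1 0 = 0)
    (hC0 : C 0 0 = 0) (hB0 : B 1 1 = 0) {out : RSVD22Output}
    (hout : out = fp.rsvdSpecial A B C) :
    ∃ U V P Q, StableOutput u A B C (fp.prodM A B C) out.U out.V out.B' out.C'
      (zero12 (fp.mulM out.Qᵀ out.H)) (zero12 (fp.mulM out.K out.P)) U V P Q := by
  have hw := logUnit_nonneg hu hu'
  have hM : fp.prodM A B C = 0 := by
    have h0 : fp.sub 0 0 = 0 := by
      obtain ⟨e, -, h⟩ := fp.sub_err 0 0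
      simpa using h
    ext i j
    fin_cases i <;> fin_cases j <;>
      simp [prodM, hC0, hB0, fp.zero_mul, fp.mul_zero, fp.add_zero_zero, h0]
  subst hout
  rw [hM]
  unfold rsvdSpecial
  dsimp only
  obtain ⟨cv, sv, hv, dv, rcv, rsv⟩ := fp.lartg_relClose hu hu' (C 0 1) (C 1 1)
  obtain ⟨cu, su, hu1, du, rcu, rsu⟩ := fp.lartg_relClose hu hu' (B 0 1) (B 0 0)
  have oV := rotCS_orthogonal hv
  have oU := rotCS_orthogonal hu1
  have cV := relClose_rotCS rcv rsv
  have cU := relClose_rotCS rcu rsu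
  have e0 : (rotCS (cv, sv) * C) 0 0 = 0 ∧ (rotCS (cv, sv) * C) 1 0 = 0 ∧
      (rotCS (cv, sv) * C) 1 1 = 0 := by
    simp [rotCS, Matrix.mul_apply, Fin.sum_univ_two, hC, hC0]
    linarith
  have e1 : (B * rotCS (cu, su)) 0 0 = 0 ∧ (B * rotCS (cu, su)) 1 0 = 0 ∧
      (B * rotCS (cu, su)) 1 1 = 0 := by
    simp [rotCS, Matrix.mul_apply, Fin.sum_univ_two, hB, hB0]
    linarith
  rw [Matrix.transpose_transpose]
  generalize rotCS (fp.lartg (C 0 1) (C 1 1)) = Vb at *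
  generalize rotCS (fp.lartg (B 0 1) (B 0 0)) = Ub at *
  generalize rotCS (cv, sv) = V at *
  generalize rotCS (cu, su) = U at *
  have z : ∀ X : Mat2, ∀ i j, NearBy u 0 (X i j) (X i j) (absM X i j) :=
    fun X i j => .refl hw le_rfl
  have nV : ∀ i j, NearBy u 3 (Vb i j) (V i j) (absM V i j) :=
    fun i j => .of_relClose hw (by norm_num) (cV i j)
  have nU : ∀ i j, NearBy u 3 (Ub i j) (U i j) (absM U i j) :=
    fun i j => .of_relClose hw (by norm_num) (cU i j)
  have nG := fp.mulM_nearBy hu hu' (by norm_num) le_rfl nV (z C)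
  have nL := fp.mulM_nearBy hu hu' le_rfl (by norm_num) (z B) nU
  have nK := fp.mulM_nearBy hu hu' (by norm_num) le_rfl nG (z A.adjugate)
  have nH := fp.mulM_nearBy hu hu' le_rfl (by norm_num) (z A.adjugate) nL
  have nC' := fp.mulM_nearBy hu hu' (by norm_num) le_rfl nG (z matJ)
  have nB' := fp.mulM_nearBy hu hu' le_rfl (by norm_num) (z matJᵀ) nL
  have nK' := fp.mulM_nearBy hu hu' (by norm_num) le_rfl nK (z matJ)
  have nH' := fp.mulM_nearBy hu hu' le_rfl (by norm_num) (z matJᵀ) nH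
  -- norms of the entrywise bounds
  have hJ : A.adjugate 1 0 = 0 := by rw [Matrix.adjugate_fin_two]; simp [hA]
  have hJn : ‖absM A.adjugate‖ ^ 2 ≤ ‖A‖ ^ 2 := pow_le_pow_left₀ (norm_nonneg _)
    ((Mat2.norm_absM_le _ hJ).trans (Mat2.norm_adjugate_le A)) 2
  have hBn := pow_le_pow_left₀ (norm_nonneg _) (Mat2.norm_absM_le B hB) 2
  have hCn := pow_le_pow_left₀ (norm_nonneg _) (Mat2.norm_absM_le C hC) 2
  have j1 : ‖absM matJ‖ ^ 2 ≤ 4 := by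
    have : ‖absM matJ‖ ≤ 2 :=
      Mat2.norm_le_of_sum_sq_le _ (by norm_num) (by simp [absM, matJ]; norm_num)
    nlinarith [norm_nonneg (absM matJ)]
  have j2 : ‖absM matJᵀ‖ ^ 2 ≤ 4 := by
    have : ‖absM matJᵀ‖ ≤ 2 :=
      Mat2.norm_le_of_sum_sq_le _ (by norm_num) (by simp [absM, matJ]; norm_num)
    nlinarith [norm_nonneg (absM matJᵀ)]
  have row : ∀ {X Y : Mat2} {a b : ℝ}, 0 ≤ a → ‖Y‖ ^ 2 ≤ b → (∀ i, X i 0 ^ 2 + X i 1 ^ 2 ≤ a) →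
      ∀ i, (X * Y) i 0 ^ 2 + (X * Y) i 1 ^ 2 ≤ b * a := fun h0 hY hX i =>
    (Mat2.row_mul_sq_le _ _ i).trans (mul_le_mul hY (hX i) (by positivity)
      ((sq_nonneg _).trans hY))
  have col : ∀ {X Y : Mat2} {a b : ℝ}, 0 ≤ a → ‖X‖ ^ 2 ≤ b → (∀ j, Y 0 j ^ 2 + Y 1 j ^ 2 ≤ a) →
      ∀ j, (X * Y) 0 j ^ 2 + (X * Y) 1 j ^ 2 ≤ b * a := fun h0 hX hY j =>
    (Mat2.col_mul_sq_le _ _ j).trans (mul_le_mul hX (hY j) (by positivity)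
      ((sq_nonneg _).trans hX))
  have rV : ∀ i, absM V i 0 ^ 2 + absM V i 1 ^ 2 ≤ 1 := fun i =>
    (sum_sq_abs_col (X := Vᵀ) (by simpa using oV.2) i).le
  have rU : ∀ j, absM U 0 j ^ 2 + absM U 1 j ^ 2 ≤ 1 := fun j => (sum_sq_abs_col oU.1 j).le
  have rG := row zero_le_one hCn rV
  have rK := row (by positivity) hJn rG
  have cL := col zero_le_one hBn rU
  have cH := col (by positivity) hJn cL
  have rC' := row (by positivity) j1 rG
  have rK' := row (by positivity) j1 rK
  have cB' := col (by positivity) j2 cL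
  have cH' := col (by positivity) j2 cH
  have J1 := matJ_orthogonal.1
  refine ⟨U, Vᵀ, matJ, matJ, oU.1, by simpa using oV.2, J1, J1,
    by simp [Matrix.isDiag_zero], by simp, ?_, ?_, ?_, ?_, ⟨0, 0, ?_, ?_, ?_⟩, ⟨0, 0, ?_, ?_, ?_⟩⟩
  · refine norm_sub_le_of_nearBy_or_eq hu hu' (norm_nonneg B)
      (Wh := absM matJᵀ * (absM B * absM U)) (fun i j => ?_) (by linarith [cB' 0, cB' 1])
    fin_cases i <;> fin_cases j
    · exact Or.inl ((nB' 0 0).mono hw (by norm_num))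
    · exact Or.inl ((nB' 0 1).mono hw (by norm_num))
    · right
      simp [zero21, matJ, Matrix.mul_apply (M := !![_, _; _, _]ᵀ), Fin.sum_univ_two, e1.1]
    · exact Or.inl ((nB' 1 1).mono hw (by norm_num))
  · rw [Matrix.transpose_transpose]
    refine norm_sub_le_of_nearBy_or_eq hu hu' (norm_nonneg C)
      (Wh := absM V * absM C * absM matJ) (fun i j => ?_) (by linarith [rC' 0, rC' 1])
    fin_cases i <;> fin_cases j
    · exact Or.inl ((nC' 0 0).mono hw (by norm_num))
    · exact Or.inl ((nC' 0 1).mono hw (by norm_num))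
    · right
      change 0 = (V * C * matJ) 1 0
      rw [Matrix.mul_apply, Fin.sum_univ_two, e0.2.1, e0.2.2]
      simp
    · exact Or.inl ((nC' 1 1).mono hw (by norm_num))
  · refine norm_sub_le_of_nearBy_or_eq hu hu' (by positivity)
      (Wh := absM matJᵀ * (absM A.adjugate * (absM B * absM U))) (fun i j => ?_)
      (by rw [mul_pow]; linarith [cH' 0, cH' 1])
    fin_cases i <;> fin_cases j
    · exact Or.inl ((nH' 0 0).mono hw (by norm_num))
    · right
      change 0 = (matJᵀ * (A.adjugate * (B * U))) 0 1
      rw [Matrix.mul_apply, Fin.sum_univ_two, Matrix.mul_apply (M := A.adjugate) (i := 1),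
        Fin.sum_univ_two, hJ, e1.2.2]
      simp [matJ]
    · exact Or.inl ((nH' 1 0).mono hw (by norm_num))
    · exact Or.inl ((nH' 1 1).mono hw (by norm_num))
  · rw [Matrix.transpose_transpose]
    refine norm_sub_le_of_nearBy_or_eq hu hu' (by positivity)
      (Wh := absM V * absM C * absM A.adjugate * absM matJ) (fun i j => ?_)
      (by rw [mul_pow]; linarith [rK' 0, rK' 1])
    fin_cases i <;> fin_cases j
    · exact Or.inl ((nK' 0 0).mono hw (by norm_num))
    · right
      change 0 = (V * C * A.adjugate * matJ) 0 1
      rw [Matrix.mul_apply, Fin.sum_univ_two, Matrix.mul_apply (M := V * C) (i := 0) (k := 0),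
        Fin.sum_univ_two, hJ, e0.1]
      simp [matJ]
    · exact Or.inl ((nK' 1 0).mono hw (by norm_num))
    · exact Or.inl ((nK' 1 1).mono hw (by norm_num))
  · simp; positivity
  · simp; positivity
  · intro i j hij
    fin_cases i <;> fin_cases j <;>
      simp [mulM, zero12, zero21, matJ, Matrix.mul_apply, Fin.sum_univ_two, hB, hB0, hC, hC0,
        hJ, fp.mul_zero, fp.zero_mul, fp.add_zero_zero] at hij ⊢
  · simp; positivity
  · simp; positivity
  · intro i j hij
    fin_cases i <;> fin_cases j <;>
      simp [mulM, zero12, zero21, matJ, Matrix.mul_apply, Fin.sum_univ_two, hB, hB0, hC, hC0,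
        hJ, fp.mul_zero, fp.zero_mul, fp.add_zero_zero] at hij ⊢

theorem FloatModel.rsvd22_stable {u : ℝ} (hu : 0 < u) (hu' : u ≤ 1 / 10 ^ 6)
    (fp : FloatModel u) {A B C : Mat2} (hA : A 1 0 = 0) (hB : B 1 0 = 0) (hC : C 1 0 = 0)
    (hdet : A.det ≠ 0) (zg zl : Bool) {out : RSVD22Output} (hout : out = fp.rsvd22 A B C zg zl) :
    ∃ U V P Q, StableOutput u A B C (fp.prodM A B C) out.U out.V out.B' out.C'
      (zero12 (fp.mulM out.Qᵀ out.H)) (zero12 (fp.mulM out.K out.P)) U V P Q := by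
  unfold rsvd22 at hout
  split_ifs at hout with h
  · exact fp.rsvdSpecial_stable hu hu' hA hB hC h.1 h.2 hout
  · exact fp.rsvdGeneric_stable hu hu' hA hB hC hdet h zg zl hout

theorem FloatModel.rsvd22_triangular {u : ℝ} (fp : FloatModel u) {A B C : Mat2} (hA : A 1 0 = 0)
    (hB : B 1 0 = 0) (hC : C 1 0 = 0) (zg zl : Bool) {out : RSVD22Output}
    (hout : out = fp.rsvd22 A B C zg zl) :
    out.A' 0 1 = 0 ∧ out.B' 0 1 = 0 ∧ out.C' 0 1 = 0 := by
  subst hout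
  unfold rsvd22
  split_ifs with h
  · simp [rsvdSpecial, mulM, zero21, matJ, hA, hB, hC, h.1, h.2, fp.mul_zero, fp.zero_mul,
      fp.add_zero_zero]
  · exact ⟨rfl, rfl, rfl⟩

/-- A matrix close to `Pᵀ X U` is orthogonally equivalent to a matrix close to `X`. -/
theorem exists_backward_error {P U X Z : Mat2} {c : ℝ} (hP₁ : Pᵀ * P = 1)
    (hU₁ : Uᵀ * U = 1) (h : ‖Z - Pᵀ * X * U‖ ≤ c) :
    ∃ δ : Mat2, Z = Pᵀ * (X + δ) * U ∧ ‖δ‖ ≤ c := by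
  have hU₂ : U * Uᵀ = 1 := mul_eq_one_comm.mp hU₁
  refine ⟨P * (Z - Pᵀ * X * U) * Uᵀ, ?_, ?_⟩
  · have e : Pᵀ * (P * (Z - Pᵀ * X * U) * Uᵀ) * U =
        (Pᵀ * P) * (Z - Pᵀ * X * U) * (Uᵀ * U) := by simp only [Matrix.mul_assoc]
    rw [Matrix.mul_add, Matrix.add_mul, e, hP₁, hU₁, Matrix.one_mul, Matrix.mul_one]
    abel
  · refine (Mat2.norm_mul_mul_le (Mat2.norm_le_one_of_orthogonal hP₁) ?_).trans h
    exact Mat2.norm_le_one_of_orthogonal (by simpa using hU₂)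

theorem mainTheorem2 :
    ∃ κ u₀ : ℝ, 0 < κ ∧ 0 < u₀ ∧
      ∀ (u : ℝ), 0 < u → u ≤ u₀ →
      ∀ (fp : FloatModel u) (A B C : Matrix (Fin 2) (Fin 2) ℝ),
        A 1 0 = 0 → B 1 0 = 0 → C 1 0 = 0 → A.det ≠ 0 →
      ∀ (zg zl : Bool) (out : RSVD22Output) (M H' K' : Matrix (Fin 2) (Fin 2) ℝ),
        out = fp.rsvd22 A B C zg zl →
        M = fp.prodM A B C →
        H' = zero12 (fp.mulM out.Qᵀ out.H) →
        K' = zero12 (fp.mulM out.K out.P) →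
        -- the outputs are exactly lower triangular
        (out.A' 0 1 = 0 ∧ out.B' 0 1 = 0 ∧ out.C' 0 1 = 0) ∧
        -- near diagonality
        (∃ D : Matrix (Fin 2) (Fin 2) ℝ, D.IsDiag ∧
          ‖out.Vᵀ * M * out.U - D‖ ≤ (132 * u + κ * u ^ 2) * ‖M‖) ∧
        -- near parallelism of rows and columns
        (∃ X Y : Matrix (Fin 2) (Fin 2) ℝ,
          ‖X‖ ≤ (86 * u + κ * u ^ 2) * ‖C‖ ∧
          ‖Y‖ ≤ (93.5 * u + κ * u ^ 2) * (‖A‖ * ‖B‖) ∧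
          ParallelRows (out.C' + X) (H'.adjugate + Y)) ∧
        (∃ X Y : Matrix (Fin 2) (Fin 2) ℝ,
          ‖X‖ ≤ (93.5 * u + κ * u ^ 2) * (‖A‖ * ‖C‖) ∧
          ‖Y‖ ≤ (86 * u + κ * u ^ 2) * ‖B‖ ∧
          ParallelCols (K'.adjugate + X) (out.B' + Y)) ∧
        -- stability
        (∃ P Q U V δB δC δH δK : Matrix (Fin 2) (Fin 2) ℝ,
          P ∈ Matrix.orthogonalGroup (Fin 2) ℝ ∧ Q ∈ Matrix.orthogonalGroup (Fin 2) ℝ ∧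
          U ∈ Matrix.orthogonalGroup (Fin 2) ℝ ∧ V ∈ Matrix.orthogonalGroup (Fin 2) ℝ ∧
          (Vᵀ * M * U).IsDiag ∧
          out.B' = Pᵀ * (B + δB) * U ∧
          H' = Qᵀ * (A.adjugate * B + δH) * U ∧
          out.C' = Vᵀ * (C + δC) * Q ∧
          K' = Vᵀ * (C * A.adjugate + δK) * P ∧
          ‖δB‖ ≤ (493 * u + κ * u ^ 2) * ‖B‖ ∧
          ‖δC‖ ≤ (493 * u + κ * u ^ 2) * ‖C‖ ∧
          ‖δH‖ ≤ (486 * u + κ * u ^ 2) * (‖A‖ * ‖B‖) ∧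
          ‖δK‖ ≤ (486 * u + κ * u ^ 2) * (‖A‖ * ‖C‖)) := by
  refine ⟨1, 1 / 10 ^ 6, one_pos, by norm_num, ?_⟩
  intro u hu hu' fp A B C hA hB hC hdet zg zl out M H' K' hout hM hH' hK'
  obtain ⟨U, V, P, Q, S⟩ := fp.rsvd22_stable hu hu' hA hB hC hdet zg zl hout
  rw [← hM, ← hH', ← hK'] at S
  have bound : ∀ {x c d m : ℝ}, c ≤ d → 0 ≤ m → x ≤ c * u * m → x ≤ (d * u + 1 * u ^ 2) * m := by
    intro x c d m hcd hm hx
    refine hx.trans (mul_le_mul_of_nonneg_right ?_ hm)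
    nlinarith
  have hAB := mul_nonneg (norm_nonneg A) (norm_nonneg B)
  have hAC := mul_nonneg (norm_nonneg A) (norm_nonneg C)
  have adj_add : ∀ X Y : Mat2, X.adjugate + Y.adjugate = (X + Y).adjugate := by
    intro X Y
    simp only [Matrix.adjugate_fin_two]
    ext i j
    fin_cases i <;> fin_cases j <;> simp <;> ring
  have orth : ∀ {X : Mat2}, Xᵀ * X = 1 → X ∈ Matrix.orthogonalGroup (Fin 2) ℝ := fun h =>
    Matrix.mem_unitaryGroup_iff'.mpr (by
      rwa [Matrix.star_eq_conjTranspose, Matrix.conjTranspose_eq_transpose_of_trivial])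
  refine ⟨fp.rsvd22_triangular hA hB hC zg zl hout,
    ⟨_, S.M_diag, bound le_rfl (norm_nonneg M) S.near_M⟩, ?_, ?_, ?_⟩
  · obtain ⟨X, Y, hX, hY, hd⟩ := S.diag_CH
    refine ⟨X, Y.adjugate, bound (by norm_num) (norm_nonneg C) hX,
      bound (by norm_num) hAB ((Mat2.norm_adjugate_le Y).trans hY), ?_⟩
    rw [adj_add]
    exact parallelRows_of_isDiag_mul hd
  · obtain ⟨X, Y, hX, hY, hd⟩ := S.diag_KB
    refine ⟨X.adjugate, Y, bound (by norm_num) hAC ((Mat2.norm_adjugate_le X).trans hX),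
      bound (by norm_num) (norm_nonneg B) hY, ?_⟩
    rw [adj_add]
    exact parallelCols_of_isDiag_mul hd
  · have near_B : ‖out.B' - Pᵀ * B * U‖ ≤ 480 * u * ‖B‖ := by
      rw [Matrix.mul_assoc]; exact S.near_B
    have near_H : ‖H' - Qᵀ * (A.adjugate * B) * U‖ ≤ 480 * u * (‖A‖ * ‖B‖) := by
      rw [Matrix.mul_assoc, Matrix.mul_assoc]; exact S.near_H
    have near_K : ‖K' - Vᵀ * (C * A.adjugate) * P‖ ≤ 480 * u * (‖A‖ * ‖C‖) := by
      rw [← Matrix.mul_assoc]; exact S.near_K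
    obtain ⟨δB, eB, nB⟩ := exists_backward_error S.P₁ S.U₁ near_B
    obtain ⟨δC, eC, nC⟩ := exists_backward_error S.V₁ S.Q₁ S.near_C
    obtain ⟨δH, eH, nH⟩ := exists_backward_error S.Q₁ S.U₁ near_H
    obtain ⟨δK, eK, nK⟩ := exists_backward_error S.V₁ S.P₁ near_K
    exact ⟨P, Q, U, V, δB, δC, δH, δK, orth S.P₁, orth S.Q₁, orth S.U₁, orth S.V₁, S.M_diag,
      eB, eH, eC, eK, bound (by norm_num) (norm_nonneg B) nB,
      bound (by norm_num) (norm_nonneg C) nC, bound (by norm_num) hAB nH,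
      bound (by norm_num) hAC nK⟩
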